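/- Let $A$ be a commutative Noetherian ring, $M$ a finitely generated $A$-module, $n\ge 1$, $x_1,\dots,x_n\in A$ and $\mathfrak a=(x_1,\dots,x_n)$. Suppose that $x_1,\dots,x_n$ is an $\mathfrak a$-filter regular sequence on $M$, i.e. for every $0\le i<n$ and every $m\in M$ with $x_{i+1}m\in (x_1,\dots,x_i)M$ there is an integer $r\ge 1$ with $\mathfrak a^r m\subseteq (x_1,\dots,x_i)M$. *Modules of generalized fractions.* A non-empty set $U\subseteq A^k$ ($k\ge1$) is triangular if it is closed under $(u_1,\dots,u_k)\mapsto(u_1^{\alpha_1},\dots,u_k^{\alpha_k})$ for positive integers $\alpha_j$, and for all $u,v\in U$ there are $w\in U$ and lower triangular matrices $H,K$ over $A$ with $Hu=w=Kv$. The module $U^{-k}M$ consists of the classes $\frac{a}{u}$ of pairs $(a,u)\in M\times U$, where $(a,u)\sim(b,v)$ if and only if there are $w\in U$ and lower triangular $H,K$ with $Hu=w=Kv$ and $|H|a-|K|b\in(w_1,\dots,w_{k-1})M$; the operations are $\frac au+\frac bv=\frac{|H|a+|K|b}{w}$ whenever $Hu=w=Kv$ with $w\in U$ and $H,K$ lower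 triangular, and $r\frac au=\frac{ra}{u}$. *The complex $C(\mathfrak U(x),M)$.* Put $x_r=x_n$ for $r>n$. For $i\ge1$ let $U(x)_i\subseteq A^i$ be the triangular set of all $(x_1^{\alpha_1},\dots,x_i^{\alpha_i})$ for which there is $0\le j\le i$ with $\alpha_1,\dots,\alpha_j\ge 1$ and $\alpha_{j+1}=\dots=\alpha_i=0$. The complex $C(\mathfrak U(x),M)$ is $$0\to M\xrightarrow{e^0}U(x)_1^{-1}M\xrightarrow{e^1}\cdots\to U(x)_i^{-i}M\xrightarrow{e^i}U(x)_{i+1}^{-i-1}M\to\cdots,$$ with $e^0(b)=\frac{b}{(1)}$ and $e^i\bigl(\frac{b}{(u_1,\dots,u_i)}\bigr)=\frac{(-1)^i b}{(u_1,\dots,u_i,1)}$ for $i\ge1$. *The Čech complex.* Let $C(x,M)^\bullet$ be the Čech complex of $M$ with respect to $x_1,\dots,x_n$: $C(x,M)^0=M$, and for $k\ge1$, $C(x,M)^k=\bigoplus_{1\le i(1)<\dots<i(k)\le n}M_{x_{i(1)}\cdots x_{i(k)}}$. Its differential $C(x,M)^0\to C(x,M)^1$ is given by the natural maps $M\to M_{x_i}$;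 for $k\ge1$, the component of $C(x,M)^k\to C(x,M)^{k+1}$ from the summand of $i(1)<\dots<\widehat{i(p)}<\dots<i(k+1)$ to the summand of $i(1)<\dots<i(k+1)$ is $(-1)^{p-1}$ times the natural localization map, and all other components are $0$. *The map $\Theta_x$.* There is a homomorphism of complexes $\Theta_x=(\theta_x^i)_{i\ge0}\colon C(x,M)^\bullet\to C(\mathfrak U(x),M)$ such that $\theta_x^0=\mathrm{id}_M$; for $1\le k\le n$, $\theta_x^k$ is the $A$-homomorphism with $$\theta_x^k\Bigl(\frac{m}{(x_{i(1)}\cdots x_{i(k)})^\alpha}\Bigr)=\begin{cases}\dfrac{m}{(x_1^\alpha,\dots,x_k^\alpha)}&\text{if }(i(1),\dots,i(k))=(1,\dots,k),\\ 0&\text{otherwise;}\end{cases}$$ and $\theta_x^i=0$ for $i>n$. **Theorem.** The chain map $\Theta_x\colon C(x,M)^\bullet\to C(\mathfrak U(x),M)$ is a quasi-isomorphism. -/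

import Mathlib

universe u

section

open Matrix

/-- The ideal generated by the first `k` of the `k + 1` entries of `w`. -/
def lowIdeal {A : Type*} [CommRing A] {k : ℕ} (w : Fin (k + 1) → A) : Ideal A :=
  Ideal.span (Set.range fun i : Fin k => w i.castSucc)

/-- A triangular subset `U` of `A ^ n` in the sense of Sharp and Zakeri: it is non-empty, closed
under raising the entries to arbitrary positive powers, and any two `u, v ∈ U` have a common
multiple `w = H u = K v` in `U` with lower triangular `H`, `K`. -/
structure TriangularSubset (A : Type*) [CommRing A] (n : ℕ) where
  carrier : Set (Fin n → A)
  nonempty : carrier.Nonempty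
  pow_mem : ∀ u ∈ carrier, ∀ α : Fin n → ℕ, (∀ i, 0 < α i) → (fun i => u i ^ α i) ∈ carrier
  exists_common : ∀ u ∈ carrier, ∀ v ∈ carrier, ∃ w ∈ carrier,
    ∃ H K : Matrix (Fin n) (Fin n) A, H.IsLowerTriangular ∧ K.IsLowerTriangular ∧ H *ᵥ u = w ∧ K *ᵥ v = w

namespace LowerTri

variable {A : Type*} [CommRing A] {n k : ℕ}

theorem apply_eq_zero {H : Matrix (Fin n) (Fin n) A} (hH : H.IsLowerTriangular) {i j : Fin n}
    (h : i < j) : H i j = 0 := hH (OrderDual.toDual_lt_toDual.2 h)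

theorem det_eq {H : Matrix (Fin n) (Fin n) A} (hH : H.IsLowerTriangular) : H.det = ∏ i, H i i :=
  det_of_isLowerTriangular H hH

/-- the leading principal block -/
def lead (H : Matrix (Fin (k + 1)) (Fin (k + 1)) A) : Matrix (Fin k) (Fin k) A :=
  H.submatrix Fin.castSucc Fin.castSucc

theorem lead_tri {H : Matrix (Fin (k + 1)) (Fin (k + 1)) A} (hH : H.IsLowerTriangular) :
    (lead H).IsLowerTriangular := fun i j h => hH (by simpa using h)

theorem det_succ {H : Matrix (Fin (k + 1)) (Fin (k + 1)) A} (hH : H.IsLowerTriangular) :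
    H.det = (lead H).det * H (Fin.last k) (Fin.last k) := by
  rw [(det_eq hH), (det_eq (lead_tri hH)), Fin.prod_univ_castSucc]; rfl

theorem lead_mulVec {H : Matrix (Fin (k + 1)) (Fin (k + 1)) A} (hH : H.IsLowerTriangular)
    (u : Fin (k + 1) → A) :
    lead H *ᵥ (fun i => u i.castSucc) = fun i => (H *ᵥ u) i.castSucc := by
  ext i
  simp only [mulVec, dotProduct, Fin.sum_univ_castSucc]
  rw [apply_eq_zero hH (Fin.castSucc_lt_last i)]
  simp [lead]

theorem det_mul_mem_span {H : Matrix (Fin n) (Fin n) A} {u w : Fin n → A} (h : H *ᵥ u = w)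
    (i : Fin n) : H.det * u i ∈ Ideal.span (Set.range w) := by
  have : H.det • u = H.adjugate *ᵥ w := by
    rw [← h, mulVec_mulVec, adjugate_mul, smul_mulVec, one_mulVec]
  have h2 := congrFun this i
  simp only [Pi.smul_apply, smul_eq_mul] at h2
  rw [h2]
  simp only [mulVec, dotProduct]
  exact Ideal.sum_mem _ fun j _ => Ideal.mul_mem_left _ _ (Ideal.subset_span (Set.mem_range_self j))

theorem det_mul_mem {H : Matrix (Fin (k + 1)) (Fin (k + 1)) A} (hH : H.IsLowerTriangular)
    {u w : Fin (k + 1) → A} (h : H *ᵥ u = w) {r : A} (hr : r ∈ lowIdeal u) :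
    H.det * r ∈ lowIdeal w := by
  have key : lowIdeal u ≤ Submodule.comap (LinearMap.mulLeft A H.det) (lowIdeal w) := by
    refine Ideal.span_le.2 ?_
    rintro _ ⟨i, rfl⟩
    have h1 := det_mul_mem_span (lead_mulVec hH u) i
    rw [h] at h1
    have h2 := Ideal.mul_mem_left _ (H (Fin.last k) (Fin.last k)) h1
    simp only [SetLike.mem_coe, Submodule.mem_comap, LinearMap.mulLeft_apply, (det_succ hH)]
    have h3 : (lead H).det * H (Fin.last k) (Fin.last k) * u i.castSucc =
        H (Fin.last k) (Fin.last k) * ((lead H).det * u i.castSucc) := by ring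
    rw [h3]
    exact h2
  exact key hr

theorem prod_mul_mem_span_sq {w : Fin n → A} {r : A} (hr : r ∈ Ideal.span (Set.range w)) :
    (∏ i, w i) * r ∈ Ideal.span (Set.range fun i => w i ^ 2) := by
  have key : Ideal.span (Set.range w) ≤ Submodule.comap (LinearMap.mulLeft A (∏ i, w i))
      (Ideal.span (Set.range fun i => w i ^ 2)) := by
    refine Ideal.span_le.2 ?_
    rintro _ ⟨i, rfl⟩
    simp only [SetLike.mem_coe, Submodule.mem_comap, LinearMap.mulLeft_apply]
    rw [← Finset.mul_prod_erase _ _ (Finset.mem_univ i)]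
    have h1 : w i ^ 2 ∈ Ideal.span (Set.range fun i => w i ^ 2) :=
      Ideal.subset_span (Set.mem_range_self i)
    have h2 := Ideal.mul_mem_left _ (∏ x ∈ Finset.univ.erase i, w x) h1
    have h3 : w i * (∏ x ∈ Finset.univ.erase i, w x) * w i =
        (∏ x ∈ Finset.univ.erase i, w x) * w i ^ 2 := by ring
    rw [h3]
    exact h2
  exact key hr

theorem key_aux {H K : Matrix (Fin (k + 1)) (Fin (k + 1)) A} (hH : H.IsLowerTriangular)
    (hK : K.IsLowerTriangular) {u w : Fin (k + 1) → A} (h : H *ᵥ u = w) (h' : K *ᵥ u = w)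
    (ih : (∏ i : Fin k, w i.castSucc) * ((lead H).det - (lead K).det) ∈
      lowIdeal fun i => w i ^ 2) :
    (∏ i, w i) * (H.det - K.det) ∈ lowIdeal fun i => w i ^ 2 := by
  set l := Fin.last k
  have e1 : w l = ∑ j : Fin k, H l j.castSucc * u j.castSucc + H l l * u l := by
    rw [← h]; simp [mulVec, dotProduct, Fin.sum_univ_castSucc, l]
  have e2 : w l = ∑ j : Fin k, K l j.castSucc * u j.castSucc + K l l * u l := by
    rw [← h']; simp [mulVec, dotProduct, Fin.sum_univ_castSucc, l]
  set s := ∑ j : Fin k, H l j.castSucc * u j.castSucc with hs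
  set t := ∑ j : Fin k, K l j.castSucc * u j.castSucc with ht
  have hsu : s ∈ lowIdeal u :=
    Ideal.sum_mem _ fun j _ => Ideal.mul_mem_left _ _ (Ideal.subset_span ⟨j, rfl⟩)
  have htu : t ∈ lowIdeal u :=
    Ideal.sum_mem _ fun j _ => Ideal.mul_mem_left _ _ (Ideal.subset_span ⟨j, rfl⟩)
  have hz : w l * (H l l - K l l) = (H l l - K l l) * s + H l l * (t - s) := by
    linear_combination (H l l - K l l) * e1 - H l l * (e1 - e2)
  have hzu : w l * (H l l - K l l) ∈ lowIdeal u := by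
    rw [hz]
    exact Ideal.add_mem _ (Ideal.mul_mem_left _ _ hsu)
      (Ideal.mul_mem_left _ _ (Ideal.sub_mem _ htu hsu))
  have h3 : (lead H).det * (w l * (H l l - K l l)) ∈ lowIdeal w := by
    have key : lowIdeal u ≤ Submodule.comap (LinearMap.mulLeft A (lead H).det) (lowIdeal w) := by
      refine Ideal.span_le.2 ?_
      rintro _ ⟨i, rfl⟩
      have h1 := det_mul_mem_span (lead_mulVec hH u) i
      rwa [h] at h1
    exact key hzu
  have h4 := prod_mul_mem_span_sq h3
  have : (∏ i, w i) * (H.det - K.det) =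
      (∏ i : Fin k, w i.castSucc) * ((lead H).det * (w l * (H l l - K l l))) +
      (w l * K l l) * ((∏ i : Fin k, w i.castSucc) * ((lead H).det - (lead K).det)) := by
    rw [(det_succ hH), (det_succ hK), Fin.prod_univ_castSucc]
    ring
  rw [this]
  exact Ideal.add_mem _ h4 (Ideal.mul_mem_left _ _ ih)

theorem key_weak : ∀ {n : ℕ} {H K : Matrix (Fin n) (Fin n) A} (_ : H.IsLowerTriangular)
    (_ : K.IsLowerTriangular) {u w : Fin n → A} (_ : H *ᵥ u = w) (_ : K *ᵥ u = w),
    (∏ i, w i) * (H.det - K.det) ∈ Ideal.span (Set.range fun i => w i ^ 2)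
  | 0, H, K, _, _, u, w, _, _ => by simp
  | k + 1, H, K, hH, hK, u, w, h, h' => by
    have hle : lowIdeal (fun i => w i ^ 2) ≤ Ideal.span (Set.range fun i => w i ^ 2) :=
      Ideal.span_mono (by rintro _ ⟨i, rfl⟩; exact ⟨i.castSucc, rfl⟩)
    exact hle (key_aux hH hK h h' (key_weak (lead_tri hH) (lead_tri hK)
      ((lead_mulVec hH u).trans (by rw [h])) ((lead_mulVec hK u).trans (by rw [h']))))

/-- Two lower triangular matrices carrying `u` to `w` have the same determinant up to the
ambiguity that the modules of generalized fractions ignore. -/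
theorem key {H K : Matrix (Fin (k + 1)) (Fin (k + 1)) A} (hH : H.IsLowerTriangular)
    (hK : K.IsLowerTriangular) {u w : Fin (k + 1) → A} (h : H *ᵥ u = w) (h' : K *ᵥ u = w) :
    (∏ i, w i) * (H.det - K.det) ∈ lowIdeal fun i => w i ^ 2 :=
  key_aux hH hK h h' (key_weak (lead_tri hH) (lead_tri hK)
      ((lead_mulVec hH u).trans (by rw [h])) ((lead_mulVec hK u).trans (by rw [h'])))

end LowerTri

namespace GenFrac

variable {A : Type*} [CommRing A] {k : ℕ} {M : Type*} [AddCommGroup M] [Module A M]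

/-- Two elements `(a, u)` and `(b, v)` of `M × U` are identified when there are `w ∈ U` and lower
triangular `H`, `K` with `H u = w = K v` and `|H| a - |K| b ∈ (w_1, …, w_{n-1}) M`. -/
def Rel (U : TriangularSubset A (k + 1)) (M : Type*) [AddCommGroup M] [Module A M]
    (p q : M × U.carrier) : Prop :=
  ∃ w ∈ U.carrier, ∃ H K : Matrix (Fin (k + 1)) (Fin (k + 1)) A,
    H.IsLowerTriangular ∧ K.IsLowerTriangular ∧ H *ᵥ p.2.1 = w ∧ K *ᵥ q.2.1 = w ∧
      H.det • p.1 - K.det • q.1 ∈ lowIdeal w • (⊤ : Submodule A M)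

theorem det_smul_mem {H : Matrix (Fin (k + 1)) (Fin (k + 1)) A} (hH : H.IsLowerTriangular)
    {u w : Fin (k + 1) → A} (h : H *ᵥ u = w) {m : M} (hm : m ∈ lowIdeal u • (⊤ : Submodule A M)) :
    H.det • m ∈ lowIdeal w • (⊤ : Submodule A M) := by
  induction hm using Submodule.smul_induction_on' with
  | smul r hr n hn =>
    rw [smul_smul]
    exact Submodule.smul_mem_smul (LowerTri.det_mul_mem hH h hr) hn
  | add x hx y hy h1 h2 => rw [smul_add]; exact Submodule.add_mem _ h1 h2

theorem sq_mem (U : TriangularSubset A (k + 1)) {w : Fin (k + 1) → A} (hw : w ∈ U.carrier) :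
    (fun i => w i ^ 2) ∈ U.carrier := U.pow_mem w hw (fun _ => 2) (fun _ => by norm_num)

theorem diag_mulVec_self (w : Fin (k + 1) → A) :
    diagonal w *ᵥ w = fun i => w i ^ 2 := by
  ext i; rw [mulVec_diagonal, sq]

/-- Same vector, two matrices. -/
theorem det_smul_sub_mem {H K : Matrix (Fin (k + 1)) (Fin (k + 1)) A} (hH : H.IsLowerTriangular)
    (hK : K.IsLowerTriangular) {u w : Fin (k + 1) → A} (h : H *ᵥ u = w) (h' : K *ᵥ u = w) (m : M) :
    (diagonal w).det • (H.det • m - K.det • m) ∈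
      lowIdeal (fun i => w i ^ 2) • (⊤ : Submodule A M) := by
  rw [← sub_smul, smul_smul, det_diagonal]
  exact Submodule.smul_mem_smul (LowerTri.key hH hK h h') trivial

/-- `c / z = 0` -/
def Null (U : TriangularSubset A (k + 1)) (z : Fin (k + 1) → A) (c : M) : Prop :=
  ∃ y ∈ U.carrier, ∃ H : Matrix (Fin (k + 1)) (Fin (k + 1)) A,
    H.IsLowerTriangular ∧ H *ᵥ z = y ∧ H.det • c ∈ lowIdeal y • (⊤ : Submodule A M)

variable {U : TriangularSubset A (k + 1)}

theorem Null.neg {z : Fin (k + 1) → A} {c : M} (h : Null U z c) : Null U z (-c) := by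
  obtain ⟨y, hy, H, hH, e, hm⟩ := h
  exact ⟨y, hy, H, hH, e, by rw [smul_neg]; exact Submodule.neg_mem _ hm⟩

theorem Null.smul {z : Fin (k + 1) → A} {c : M} (r : A) (h : Null U z c) : Null U z (r • c) := by
  obtain ⟨y, hy, H, hH, e, hm⟩ := h
  exact ⟨y, hy, H, hH, e, by rw [smul_comm]; exact Submodule.smul_mem _ _ hm⟩

theorem Null.add {z : Fin (k + 1) → A} {c d : M} (hc : Null U z c) (hd : Null U z d) :
    Null U z (c + d) := by
  obtain ⟨y, hy, H, hH, e, hm⟩ := hc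
  obtain ⟨y', hy', H', hH', e', hm'⟩ := hd
  obtain ⟨w, hw, P, Q, hP, hQ, eP, eQ⟩ := U.exists_common y hy y' hy'
  have h1 := det_smul_mem hP eP hm
  have h2 := det_smul_mem hQ eQ hm'
  rw [smul_smul, ← det_mul] at h1 h2
  have e1 : (P * H) *ᵥ z = w := by rw [← mulVec_mulVec, e, eP]
  have e2 : (Q * H') *ᵥ z = w := by rw [← mulVec_mulVec, e', eQ]
  have h1' := det_smul_mem (blockTriangular_diagonal w) (diag_mulVec_self w) h1
  have h2' := det_smul_mem (blockTriangular_diagonal w) (diag_mulVec_self w) h2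
  have h3 := det_smul_sub_mem (hP.mul hH) (hQ.mul hH') e1 e2 d
  refine ⟨_, sq_mem U hw, diagonal w * (P * H), (blockTriangular_diagonal w).mul (hP.mul hH),
    by rw [← mulVec_mulVec, e1, diag_mulVec_self], ?_⟩
  convert Submodule.add_mem _ (Submodule.add_mem _ h1' h2') h3 using 1
  rw [det_mul]
  module

theorem Null.mono {z w : Fin (k + 1) → A} {c : M} {P : Matrix (Fin (k + 1)) (Fin (k + 1)) A}
    (hP : P.IsLowerTriangular) (e : P *ᵥ z = w) (hw : w ∈ U.carrier) (hc : Null U z c) :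
    Null U w (P.det • c) := by
  obtain ⟨y, hy, H, hH, eH, hm⟩ := hc
  obtain ⟨v, hv, Q, R, hQ, hR, eQ, eR⟩ := U.exists_common y hy w hw
  have e1 : (R * P) *ᵥ z = v := by rw [← mulVec_mulVec, e, eR]
  have e2 : (Q * H) *ᵥ z = v := by rw [← mulVec_mulVec, eH, eQ]
  have h1 := det_smul_mem (blockTriangular_diagonal v) (diag_mulVec_self v) (det_smul_mem hQ eQ hm)
  have h3 := det_smul_sub_mem (hR.mul hP) (hQ.mul hH) e1 e2 c
  refine ⟨_, sq_mem U hv, diagonal v * R, (blockTriangular_diagonal v).mul hR,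
    by rw [← mulVec_mulVec, eR, diag_mulVec_self], ?_⟩
  convert Submodule.add_mem _ h1 h3 using 1
  simp only [det_mul]
  module

theorem Null.of_mono {z w : Fin (k + 1) → A} {c : M} {P : Matrix (Fin (k + 1)) (Fin (k + 1)) A}
    (hP : P.IsLowerTriangular) (e : P *ᵥ z = w) (hc : Null U w (P.det • c)) : Null U z c := by
  obtain ⟨y, hy, H, hH, eH, hm⟩ := hc
  exact ⟨y, hy, H * P, hH.mul hP, by rw [← mulVec_mulVec, e, eH],
    by rwa [det_mul, mul_smul]⟩

theorem Null.of_mem {z : Fin (k + 1) → A} (hz : z ∈ U.carrier) {c : M}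
    (hc : c ∈ lowIdeal z • (⊤ : Submodule A M)) : Null U z c :=
  ⟨z, hz, 1, blockTriangular_one, one_mulVec z, by rwa [det_one, one_smul]⟩

/-- The relation can be tested on any common multiple of the denominators. -/
theorem rel_iff_null {p q : M × U.carrier} {w : Fin (k + 1) → A} (hw : w ∈ U.carrier)
    {H K : Matrix (Fin (k + 1)) (Fin (k + 1)) A} (hH : H.IsLowerTriangular)
    (hK : K.IsLowerTriangular) (eH : H *ᵥ p.2.1 = w) (eK : K *ᵥ q.2.1 = w) :
    Rel U M p q ↔ Null U w (H.det • p.1 - K.det • q.1) := by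
  constructor
  · rintro ⟨y, hy, P, Q, hP, hQ, eP, eQ, hm⟩
    obtain ⟨v, hv, R, S, hR, hS, eR, eS⟩ := U.exists_common w hw y hy
    have h0 := det_smul_mem (blockTriangular_diagonal v) (diag_mulVec_self v)
      (det_smul_mem hS eS hm)
    have h1 := det_smul_sub_mem (hR.mul hH) (hS.mul hP) (u := p.2.1) (w := v)
      (by rw [← mulVec_mulVec, eH, eR]) (by rw [← mulVec_mulVec, eP, eS]) p.1
    have h2 := det_smul_sub_mem (hR.mul hK) (hS.mul hQ) (u := q.2.1) (w := v)
      (by rw [← mulVec_mulVec, eK, eR]) (by rw [← mulVec_mulVec, eQ, eS]) q.1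
    refine ⟨_, sq_mem U hv, diagonal v * R, (blockTriangular_diagonal v).mul hR,
      by rw [← mulVec_mulVec, eR, diag_mulVec_self], ?_⟩
    convert Submodule.add_mem _ (Submodule.sub_mem _ h1 h2) h0 using 1
    simp only [det_mul]
    module
  · rintro ⟨y, hy, P, hP, eP, hm⟩
    refine ⟨y, hy, P * H, P * K, hP.mul hH, hP.mul hK, by rw [← mulVec_mulVec, eH, eP],
      by rw [← mulVec_mulVec, eK, eP], ?_⟩
    convert hm using 1
    simp only [det_mul]
    module

theorem rel_equivalence (U : TriangularSubset A (k + 1)) : Equivalence (Rel U M) where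
  refl p := ⟨p.2.1, p.2.2, 1, 1, blockTriangular_one, blockTriangular_one, one_mulVec _,
    one_mulVec _, by simp⟩
  symm := by
    rintro p q ⟨w, hw, H, K, hH, hK, eH, eK, hm⟩
    refine ⟨w, hw, K, H, hK, hH, eK, eH, ?_⟩
    rw [← neg_sub]
    exact Submodule.neg_mem _ hm
  trans := by
    intro p q r hpq hqr
    obtain ⟨w, hw, H, K, hH, hK, eH, eK⟩ := U.exists_common _ p.2.2 _ q.2.2
    obtain ⟨v, hv, P, Q, hP, hQ, eP, eQ⟩ := U.exists_common _ hw _ r.2.2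
    have h1 := (rel_iff_null hv (hP.mul hH) (hP.mul hK) (by rw [← mulVec_mulVec, eH, eP])
      (by rw [← mulVec_mulVec, eK, eP])).1 hpq
    have h2 := (rel_iff_null hv (hP.mul hK) hQ (by rw [← mulVec_mulVec, eK, eP]) eQ).1 hqr
    refine (rel_iff_null hv (hP.mul hH) hQ (by rw [← mulVec_mulVec, eH, eP]) eQ).2 ?_
    convert h1.add h2 using 1
    module

/-- The setoid on `M × U` given by `Rel`. -/
def setoid (U : TriangularSubset A (k + 1)) (M : Type*) [AddCommGroup M] [Module A M] :
    Setoid (M × U.carrier) := ⟨Rel U M, rel_equivalence U⟩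

end GenFrac

/-- The module of generalized fractions `U ^ (-n) M` of `M` with respect to the triangular subset
`U` of `A ^ n`, where `n = k + 1`. -/
def GenFrac {A : Type*} [CommRing A] {k : ℕ} (U : TriangularSubset A (k + 1)) (M : Type*)
    [AddCommGroup M] [Module A M] : Type _ := Quotient (GenFrac.setoid U M)

namespace GenFrac

variable {A : Type*} [CommRing A] {k : ℕ} {M : Type*} [AddCommGroup M] [Module A M]
  {U : TriangularSubset A (k + 1)}

/-- The generalized fraction `m / (u_1, …, u_n)`. -/
def mk (m : M) (u : U.carrier) : GenFrac U M := Quotient.mk (setoid U M) (m, u)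

theorem mk_eq_mk_iff {a b : M} {u v : U.carrier} :
    (mk a u : GenFrac U M) = mk b v ↔ Rel U M (a, u) (b, v) := Quotient.eq (r := setoid U M)

theorem ind {p : GenFrac U M → Prop} (h : ∀ m u, p (mk m u)) (x : GenFrac U M) : p x :=
  Quotient.inductionOn x fun a => h a.1 a.2

theorem mk_eq_mk_same {a b : M} {u : U.carrier} :
    (mk a u : GenFrac U M) = mk b u ↔ Null U u.1 (a - b) := by
  rw [mk_eq_mk_iff, rel_iff_null u.2 blockTriangular_one blockTriangular_one
    (one_mulVec _) (one_mulVec _)]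
  simp

/-- Expanding a fraction by a lower triangular matrix. -/
theorem mk_expand (a : M) {u w : U.carrier} {H : Matrix (Fin (k + 1)) (Fin (k + 1)) A}
    (hH : H.IsLowerTriangular) (e : H *ᵥ u.1 = w.1) :
    (mk a u : GenFrac U M) = mk (H.det • a) w := by
  rw [mk_eq_mk_iff, rel_iff_null w.2 hH blockTriangular_one e (one_mulVec _)]
  simpa using Null.of_mem (M := M) w.2 (Submodule.zero_mem _)

/-- Two fractions have a common denominator. -/
theorem exists_common₂ (x y : GenFrac U M) :
    ∃ (w : U.carrier) (a b : M), x = mk a w ∧ y = mk b w := by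
  induction x using ind with | h a u
  induction y using ind with | h b v
  obtain ⟨w, hw, H, K, hH, hK, eH, eK⟩ := U.exists_common _ u.2 _ v.2
  exact ⟨⟨w, hw⟩, _, _, mk_expand a hH eH, mk_expand b hK eK⟩

theorem exists_common₃ (x y z : GenFrac U M) :
    ∃ (w : U.carrier) (a b c : M), x = mk a w ∧ y = mk b w ∧ z = mk c w := by
  obtain ⟨u, a, b, rfl, rfl⟩ := exists_common₂ x y
  induction z using ind with | h c v
  obtain ⟨w, hw, H, K, hH, hK, eH, eK⟩ := U.exists_common _ u.2 _ v.2
  exact ⟨⟨w, hw⟩, _, _, _, mk_expand a hH eH, mk_expand b hH eH, mk_expand c hK eK⟩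

/-- Addition `a / u + b / v = (|H| a + |K| b) / w`, whenever `H u = w = K v`. -/
noncomputable instance : Add (GenFrac U M) where
  add x y := mk ((exists_common₂ x y).choose_spec.choose +
    (exists_common₂ x y).choose_spec.choose_spec.choose) (exists_common₂ x y).choose

theorem mk_add_mk_same (a b : M) (u : U.carrier) :
    (mk a u + mk b u : GenFrac U M) = mk (a + b) u := by
  set h := exists_common₂ (mk a u : GenFrac U M) (mk b u)
  change mk (h.choose_spec.choose + h.choose_spec.choose_spec.choose) h.choose = _
  obtain ⟨h1, h2⟩ := h.choose_spec.choose_spec.choose_spec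
  generalize h.choose_spec.choose_spec.choose = b' at h1 h2 ⊢
  generalize h.choose_spec.choose = a' at h1 h2 ⊢
  generalize h.choose = w at h1 h2 ⊢
  obtain ⟨v, hv, P, Q, hP, hQ, eP, eQ⟩ := U.exists_common _ u.2 _ w.2
  have e1 := (rel_iff_null hv hP hQ eP eQ).1 (mk_eq_mk_iff.1 h1)
  have e2 := (rel_iff_null hv hP hQ eP eQ).1 (mk_eq_mk_iff.1 h2)
  symm
  rw [mk_eq_mk_iff, rel_iff_null hv hP hQ eP eQ]
  convert e1.add e2 using 1
  module

theorem mk_add_mk {a b : M} {u v w : U.carrier} {H K : Matrix (Fin (k + 1)) (Fin (k + 1)) A}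
    (hH : H.IsLowerTriangular) (hK : K.IsLowerTriangular) (eH : H *ᵥ u.1 = w.1)
    (eK : K *ᵥ v.1 = w.1) :
    (mk a u + mk b v : GenFrac U M) = mk (H.det • a + K.det • b) w := by
  rw [mk_expand a hH eH, mk_expand b hK eK, mk_add_mk_same]

noncomputable instance : Zero (GenFrac U M) := ⟨mk 0 ⟨_, U.nonempty.some_mem⟩⟩

theorem mk_eq_mk_of_mem {a b : M} {u : U.carrier}
    (h : a - b ∈ lowIdeal u.1 • (⊤ : Submodule A M)) : (mk a u : GenFrac U M) = mk b u :=
  mk_eq_mk_same.2 (Null.of_mem u.2 h)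

theorem mk_zero (u : U.carrier) : (mk 0 u : GenFrac U M) = 0 := by
  obtain ⟨w, hw, H, K, hH, hK, eH, eK⟩ := U.exists_common _ u.2 _ U.nonempty.some_mem
  rw [mk_expand (w := ⟨w, hw⟩) _ hH eH]
  have h : (0 : GenFrac U M) = mk (K.det • 0) ⟨w, hw⟩ :=
    mk_expand (u := ⟨_, U.nonempty.some_mem⟩) (w := ⟨w, hw⟩) (0 : M) hK eK
  rw [h, smul_zero, smul_zero]

theorem mk_eq_zero_of_mem {a : M} {u : U.carrier}
    (h : a ∈ lowIdeal u.1 • (⊤ : Submodule A M)) : (mk a u : GenFrac U M) = 0 := by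
  rw [← mk_zero u]
  exact mk_eq_mk_of_mem (by simpa using h)

/-- `r (a / u) = (r a) / u`. -/
noncomputable instance : SMul A (GenFrac U M) where
  smul r := Quotient.map' (s₁ := setoid U M) (s₂ := setoid U M) (fun p => (r • p.1, p.2)) <| by
    rintro p q h
    obtain ⟨w, hw, H, K, hH, hK, eH, eK⟩ := U.exists_common _ p.2.2 _ q.2.2
    have h1 := (rel_iff_null hw hH hK eH eK).1 h
    change Rel U M (r • p.1, p.2) (r • q.1, q.2)
    refine (rel_iff_null (p := (r • p.1, p.2)) (q := (r • q.1, q.2)) hw hH hK eH eK).2 ?_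
    convert h1.smul r using 1
    module

theorem smul_mk (r : A) (a : M) (u : U.carrier) : r • (mk a u : GenFrac U M) = mk (r • a) u := rfl

noncomputable instance : Neg (GenFrac U M) := ⟨fun x => (-1 : A) • x⟩

noncomputable instance : AddCommGroup (GenFrac U M) where
  add_assoc x y z := by
    obtain ⟨w, a, b, c, rfl, rfl, rfl⟩ := exists_common₃ x y z
    simp only [mk_add_mk_same, add_assoc]
  zero_add x := by
    induction x using ind with | h a u
    rw [← mk_zero u, mk_add_mk_same, zero_add]
  add_zero x := by
    induction x using ind with | h a u
    rw [← mk_zero u, mk_add_mk_same, add_zero]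
  nsmul := nsmulRec
  zsmul := zsmulRec
  neg_add_cancel x := by
    induction x using ind with | h a u
    change (-1 : A) • mk a u + mk a u = 0
    rw [smul_mk, mk_add_mk_same, ← mk_zero u]
    simp
  add_comm x y := by
    obtain ⟨w, a, b, rfl, rfl⟩ := exists_common₂ x y
    simp only [mk_add_mk_same, add_comm]

noncomputable instance : Module A (GenFrac U M) where
  one_smul x := by induction x using ind with | h a u; rw [smul_mk, one_smul]
  mul_smul r s x := by induction x using ind with | h a u; simp only [smul_mk, mul_smul]
  smul_zero r := by
    obtain ⟨u, hu⟩ := U.nonempty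
    rw [← mk_zero ⟨u, hu⟩, smul_mk, smul_zero]
  smul_add r x y := by
    obtain ⟨w, a, b, rfl, rfl⟩ := exists_common₂ x y
    simp only [mk_add_mk_same, smul_mk, smul_add]
  add_smul r s x := by
    induction x using ind with | h a u
    simp only [smul_mk, mk_add_mk_same, add_smul]
  zero_smul x := by
    induction x using ind with | h a u
    rw [smul_mk, zero_smul, mk_zero]

/-- `m ↦ m / u` for a fixed denominator `u`. -/
noncomputable def mkHom (u : U.carrier) : M →ₗ[A] GenFrac U M where
  toFun m := mk m u
  map_add' a b := (mk_add_mk_same a b u).symm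
  map_smul' r a := (smul_mk r a u).symm

end GenFrac

namespace GenFrac

variable {A : Type*} [CommRing A] {k : ℕ} {M : Type*} [AddCommGroup M] [Module A M]

/-- The block matrix `H ⊕ (1)`. -/
def border (H : Matrix (Fin (k + 1)) (Fin (k + 1)) A) : Matrix (Fin (k + 2)) (Fin (k + 2)) A :=
  Matrix.of (Fin.snoc (α := fun _ => Fin (k + 2) → A)
    (fun i => Fin.snoc (α := fun _ => A) (H i) 0) (Fin.snoc (α := fun _ => A) 0 1))

theorem border_tri {H : Matrix (Fin (k + 1)) (Fin (k + 1)) A} (hH : H.IsLowerTriangular) :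
    (border H).IsLowerTriangular := by
  intro i j h
  have h' : i < j := h
  induction j using Fin.lastCases with
  | last =>
    induction i using Fin.lastCases with
    | last => exact absurd h' (lt_irrefl _)
    | cast i => simp [border]
  | cast j =>
    induction i using Fin.lastCases with
    | last => exact absurd h' (not_lt.2 (Fin.le_last _))
    | cast i =>
      simpa [border] using LowerTri.apply_eq_zero hH (by simpa using h')

theorem border_det {H : Matrix (Fin (k + 1)) (Fin (k + 1)) A} (hH : H.IsLowerTriangular) :
    (border H).det = H.det := by
  have h : LowerTri.lead (border H) = H := by ext i j; simp [LowerTri.lead, border]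
  rw [LowerTri.det_succ (border_tri hH), h]
  simp [border]

theorem border_mulVec (H : Matrix (Fin (k + 1)) (Fin (k + 1)) A) (u : Fin (k + 1) → A) :
    border H *ᵥ (Fin.snoc (α := fun _ => A) u 1) = Fin.snoc (α := fun _ => A) (H *ᵥ u) 1 := by
  ext i
  induction i using Fin.lastCases with
  | last =>
    rw [mulVec, dotProduct, Fin.sum_univ_castSucc]
    simp [border]
  | cast i =>
    rw [mulVec, dotProduct, Fin.sum_univ_castSucc]
    simp [border, mulVec, dotProduct]

theorem lowIdeal_le_snoc (u : Fin (k + 1) → A) :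
    lowIdeal u ≤ lowIdeal (k := k + 1) (Fin.snoc (α := fun _ => A) u 1) :=
  Ideal.span_mono (by rintro _ ⟨i, rfl⟩; exact ⟨i.castSucc, by simp⟩)

theorem mem_lowIdeal (u : Fin (k + 1) → A) (i : Fin k) : u i.castSucc ∈ lowIdeal u :=
  Ideal.subset_span (Set.mem_range_self i)

/-- The map `m / (u_1, …, u_n) ↦ m / (u_1, …, u_n, 1)`. -/
noncomputable def appendOne (U : TriangularSubset A (k + 1)) (V : TriangularSubset A (k + 2))
    (h : ∀ u ∈ U.carrier, Fin.snoc (α := fun _ => A) u 1 ∈ V.carrier) :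
    GenFrac U M →ₗ[A] GenFrac V M where
  toFun := Quotient.lift (s := setoid U M) (fun p => mk p.1 ⟨_, h _ p.2.2⟩) <| by
    rintro ⟨a, u⟩ ⟨b, v⟩ ⟨w, hw, H, K, hH, hK, eH, eK, hm⟩
    refine mk_eq_mk_iff.2 ⟨_, h w hw, border H, border K, border_tri hH, border_tri hK, ?_, ?_, ?_⟩
    · exact (border_mulVec H u.1).trans (by rw [← eH])
    · exact (border_mulVec K v.1).trans (by rw [← eK])
    · rw [border_det hH, border_det hK]
      exact Submodule.smul_mono_left (lowIdeal_le_snoc w) hm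
  map_add' x y := by
    obtain ⟨w, a, b, rfl, rfl⟩ := exists_common₂ x y
    rw [mk_add_mk_same]
    exact (mk_add_mk_same a b _).symm
  map_smul' r x := by
    induction x using ind with | h a u
    rfl

theorem appendOne_mk {U : TriangularSubset A (k + 1)} {V : TriangularSubset A (k + 2)}
    (h : ∀ u ∈ U.carrier, Fin.snoc (α := fun _ => A) u 1 ∈ V.carrier) (m : M) (u : U.carrier) :
    appendOne U V h (mk m u) = mk m ⟨_, h _ u.2⟩ := rfl

end GenFrac

section Sequence

variable {A : Type*} {n : ℕ} [NeZero n]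

/-- The infinite sequence `x_1, …, x_n, x_n, x_n, …` (indexed from `0`). -/
def seqTerm (x : Fin n → A) (r : ℕ) : A :=
  x ⟨min r (n - 1), lt_of_le_of_lt (min_le_right _ _) (Nat.sub_lt (NeZero.pos n) one_pos)⟩

theorem seqTerm_of_lt (x : Fin n → A) {r : ℕ} (h : r < n) : seqTerm x r = x ⟨r, h⟩ := by
  unfold seqTerm
  congr 1
  ext
  simp only
  omega

theorem seqTerm_of_ge (x : Fin n → A) {r s : ℕ} (hr : n ≤ r + 1) (hs : n ≤ s + 1) :
    seqTerm x r = seqTerm x s := by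
  unfold seqTerm
  congr 1
  ext
  simp only
  omega

/-- The exponents `(α_1, …, α_i)` for which there is `0 ≤ j ≤ i` such that `α_1, …, α_j` are
positive and `α_{j+1} = … = α_i = 0`. -/
def IsInitialExp {i : ℕ} (α : Fin i → ℕ) : Prop :=
  ∃ j ≤ i, (∀ r : Fin i, (r : ℕ) < j → 0 < α r) ∧ ∀ r : Fin i, j ≤ (r : ℕ) → α r = 0

theorem isInitialExp_const {i : ℕ} (c : ℕ) : IsInitialExp fun _ : Fin i => c := by
  rcases Nat.eq_zero_or_pos c with rfl | hc
  · exact ⟨0, Nat.zero_le _, fun _ h => absurd h (Nat.not_lt_zero _), fun _ _ => rfl⟩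
  · exact ⟨i, le_rfl, fun _ _ => hc, fun r h => absurd r.2 (not_lt.2 h)⟩

variable [CommRing A]

/-- The triangular subset `U(x)_i` of `A ^ i`, for `i = k + 1`. -/
def powSet (x : Fin n → A) (k : ℕ) : TriangularSubset A (k + 1) where
  carrier := {u | ∃ α : Fin (k + 1) → ℕ, IsInitialExp α ∧ u = fun r : Fin (k + 1) => seqTerm x r ^ α r}
  nonempty := ⟨_, fun _ => 0, isInitialExp_const 0, rfl⟩
  pow_mem := by
    rintro _ ⟨α, ⟨j, hj, h1, h2⟩, rfl⟩ β hβ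
    refine ⟨fun r => α r * β r, ⟨j, hj, fun r hr => Nat.mul_pos (h1 r hr) (hβ r),
      fun r hr => by simp [h2 r hr]⟩, ?_⟩
    ext r
    rw [pow_mul]
  exists_common := by
    rintro _ ⟨α, ⟨j, hj, h1, h2⟩, rfl⟩ _ ⟨β, ⟨j', hj', h1', h2'⟩, rfl⟩
    refine ⟨fun r : Fin (k + 1) => seqTerm x r ^ (α r + β r), ⟨fun r => α r + β r, ⟨max j j', max_le hj hj',
      fun r hr => ?_, fun r hr => ?_⟩, rfl⟩, diagonal fun r : Fin (k + 1) => seqTerm x r ^ β r,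
      diagonal fun r : Fin (k + 1) => seqTerm x r ^ α r, blockTriangular_diagonal _, blockTriangular_diagonal _,
      ?_, ?_⟩
    · rcases lt_max_iff.1 hr with h | h
      · exact Nat.add_pos_left (h1 r h) _
      · exact Nat.add_pos_right _ (h1' r h)
    · change α r + β r = 0
      rw [h2 r (le_trans (le_max_left _ _) hr), h2' r (le_trans (le_max_right _ _) hr)]
    · ext r; rw [mulVec_diagonal, ← pow_add, add_comm (β r)]
    · ext r; rw [mulVec_diagonal, ← pow_add]

/-- The element `(x_1 ^ α, …, x_i ^ α)` of `U(x)_i`, for `i = k + 1`. -/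
def powVec (x : Fin n → A) (k α : ℕ) : (powSet x k).carrier :=
  ⟨fun r => seqTerm x r ^ α, fun _ => α, isInitialExp_const α, rfl⟩

theorem snoc_mem_powSet (x : Fin n → A) (k : ℕ) (u : Fin (k + 1) → A)
    (hu : u ∈ (powSet x k).carrier) :
    Fin.snoc (α := fun _ => A) u 1 ∈ (powSet x (k + 1)).carrier := by
  obtain ⟨α, ⟨j, hj, h1, h2⟩, rfl⟩ := hu
  refine ⟨Fin.snoc (α := fun _ => ℕ) α 0, ⟨j, by omega, fun r hr => ?_, fun r hr => ?_⟩, ?_⟩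
  · induction r using Fin.lastCases with
    | last => simp at hr; omega
    | cast r => simpa using h1 r (by simpa using hr)
  · induction r using Fin.lastCases with
    | last => simp
    | cast r => simpa using h2 r (by simpa using hr)
  · ext r
    induction r using Fin.lastCases with
    | last => simp
    | cast r => simp

variable (M : Type*) [AddCommGroup M] [Module A M]

theorem appendOne_appendOne (x : Fin n → A) (k : ℕ) (z : GenFrac (powSet x k) M) :
    GenFrac.appendOne _ _ (snoc_mem_powSet x (k + 1))
      (GenFrac.appendOne _ _ (snoc_mem_powSet x k) z) = 0 := by
  induction z using GenFrac.ind with | h m u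
  rw [GenFrac.appendOne_mk, GenFrac.appendOne_mk]
  apply GenFrac.mk_eq_zero_of_mem
  have h := GenFrac.mem_lowIdeal (k := k + 1 + 1) (Fin.snoc (α := fun _ => A)
    (Fin.snoc (α := fun _ => A) u.1 (1 : A)) 1) (Fin.last _)
  simp only [Fin.snoc_castSucc, Fin.snoc_last] at h
  have := Submodule.smul_mem_smul h (show m ∈ (⊤ : Submodule A M) from trivial)
  rwa [one_smul] at this

theorem appendOne_mkHom (x : Fin n → A) (m : M) :
    GenFrac.appendOne _ _ (snoc_mem_powSet x 0) (GenFrac.mkHom (powVec x 0 0) m) = 0 := by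
  change GenFrac.appendOne _ _ _ (GenFrac.mk m _) = 0
  rw [GenFrac.appendOne_mk]
  apply GenFrac.mk_eq_zero_of_mem
  have h := GenFrac.mem_lowIdeal (k := 1) (Fin.snoc (α := fun _ => A)
    (powVec x 0 0).1 (1 : A)) 0
  have h0 : (Fin.snoc (α := fun _ => A) (powVec x 0 0).1 (1 : A) : Fin 2 → A)
      (Fin.castSucc 0) = 1 := by
    rw [Fin.snoc_castSucc]; simp [powVec]
  rw [h0] at h
  have := Submodule.smul_mem_smul h (show m ∈ (⊤ : Submodule A M) from trivial)
  rwa [one_smul] at this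

end Sequence

section GenFracComplex

open CategoryTheory

variable {A : Type u} [CommRing A] {n : ℕ} [NeZero n] (x : Fin n → A)
  (M : Type u) [AddCommGroup M] [Module A M]

/-- The terms of `C(𝔘(x), M)`: `M` in degree `0` and `U(x)_i ^ (-i) M` in degree `i ≥ 1`. -/
noncomputable def genFracX : ℕ → ModuleCat.{u} A
  | 0 => ModuleCat.of A M
  | k + 1 => ModuleCat.of A (GenFrac (powSet x k) M)

/-- The differentials of `C(𝔘(x), M)`: `e^0 b = b / (1)` (note that `powVec x 0 0` is `(1)`) and
`e^i (b / (u_1, …, u_i)) = (-1)^i b / (u_1, …, u_i, 1)`. -/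
noncomputable def genFracD : ∀ i, genFracX x M i ⟶ genFracX x M (i + 1)
  | 0 => ModuleCat.ofHom (GenFrac.mkHom (powVec x 0 0) : M →ₗ[A] GenFrac (powSet x 0) M)
  | k + 1 => ModuleCat.ofHom ((-1 : A) ^ (k + 1) •
      GenFrac.appendOne (M := M) (powSet x k) (powSet x (k + 1)) (snoc_mem_powSet x k))

/-- The complex `C(𝔘(x), M)` of modules of generalized fractions. -/
noncomputable def genFracComplex : CochainComplex (ModuleCat.{u} A) ℕ :=
  CochainComplex.of (genFracX x M) (genFracD x M) <| by
    rintro (_ | k)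
    · refine ModuleCat.hom_ext (LinearMap.ext fun m => ?_)
      change (-1 : A) ^ (0 + 1) • GenFrac.appendOne _ _ (snoc_mem_powSet x 0)
        (GenFrac.mkHom (powVec x 0 0) m) = 0
      rw [appendOne_mkHom, smul_zero]
    · refine ModuleCat.hom_ext (LinearMap.ext fun (m : GenFrac (powSet x k) M) => ?_)
      change (-1 : A) ^ (k + 1 + 1) • GenFrac.appendOne _ _ (snoc_mem_powSet x (k + 1))
        ((-1 : A) ^ (k + 1) • GenFrac.appendOne _ _ (snoc_mem_powSet x k) m) = 0
      have h := appendOne_appendOne M x k m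
      rw [map_smul, h, smul_zero, smul_zero]

end GenFracComplex

section Cech

variable {A : Type*} [CommRing A] {M : Type*} [AddCommGroup M] [Module A M]

/-- The fraction `m / a ^ α` in the localization `M_a`. -/
noncomputable def fracPow (a : A) (m : M) (α : ℕ) : LocalizedModule (Submonoid.powers a) M :=
  LocalizedModule.mk m ⟨a ^ α, pow_mem (Submonoid.mem_powers a) α⟩

theorem exists_fracPow {a : A} (z : LocalizedModule (Submonoid.powers a) M) :
    ∃ m α, z = fracPow a m α := by
  induction z using LocalizedModule.induction_on with | h m s
  obtain ⟨_, α, rfl⟩ := s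
  exact ⟨m, α, rfl⟩

theorem isUnit_of_dvd {a b : A} (h : a ∣ b) (s : Submonoid.powers a) :
    IsUnit (algebraMap A (Module.End A (LocalizedModule (Submonoid.powers b) M)) s) := by
  obtain ⟨_, α, rfl⟩ := s
  obtain ⟨c, rfl⟩ := h
  have h1 := IsLocalizedModule.map_units
    (LocalizedModule.mkLinearMap (Submonoid.powers (a * c)) M)
    ⟨(a * c) ^ α, pow_mem (Submonoid.mem_powers (a * c)) α⟩
  simp only [mul_pow, map_mul] at h1
  exact ((Commute.isUnit_mul_iff (Algebra.commutes (a ^ α) _)).1 h1).1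

/-- The natural map `M_a → M_b` when `a` divides `b`. -/
noncomputable def awayMap (M : Type*) [AddCommGroup M] [Module A M] {a b : A} (h : a ∣ b) :
    LocalizedModule (Submonoid.powers a) M →ₗ[A] LocalizedModule (Submonoid.powers b) M :=
  LocalizedModule.lift _ (LocalizedModule.mkLinearMap _ M) (isUnit_of_dvd h)

theorem awayMap_comp_mk {a b : A} (h : a ∣ b) :
    awayMap M h ∘ₗ LocalizedModule.mkLinearMap _ M = LocalizedModule.mkLinearMap _ M :=
  LocalizedModule.lift_comp _ _ _

theorem awayMap_awayMap {a b c : A} (h : a ∣ b) (h' : b ∣ c)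
    (z : LocalizedModule (Submonoid.powers a) M) :
    awayMap M h' (awayMap M h z) = awayMap M (h.trans h') z := by
  have : awayMap M h' ∘ₗ awayMap M h = awayMap M (h.trans h') := by
    refine IsLocalizedModule.ext (Submonoid.powers a)
      (LocalizedModule.mkLinearMap (Submonoid.powers a) M) (isUnit_of_dvd (h.trans h')) ?_
    rw [LinearMap.comp_assoc, awayMap_comp_mk, awayMap_comp_mk, awayMap_comp_mk]
  exact LinearMap.congr_fun this z

theorem awayMap_fracPow {a b c : A} (h : a ∣ b) (e : b = c * a) (m : M) (α : ℕ) :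
    awayMap M h (fracPow a m α) = fracPow b (c ^ α • m) α := by
  unfold awayMap fracPow
  rw [LocalizedModule.lift_mk, Module.End.algebraMap_isUnit_inv_apply_eq_iff]
  subst e
  rw [LocalizedModule.mkLinearMap_apply, LocalizedModule.smul'_mk, LocalizedModule.mk_eq]
  refine ⟨1, ?_⟩
  rw [one_smul, one_smul, one_smul, smul_smul, Submonoid.mk_smul, mul_pow, mul_comm]

variable {n k : ℕ}

/-- The strictly increasing sequence `S` with its `p`-th entry deleted. -/
def delEntry (S : Fin (k + 1) ↪o Fin n) (p : Fin (k + 1)) : Fin k ↪o Fin n :=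
  (Fin.succAboveOrderEmb p).trans S

/-- The product `x_{S(1)} ⋯ x_{S(k)}`. -/
def cechProd (x : Fin n → A) (S : Fin k ↪o Fin n) : A := ∏ j, x (S j)

theorem cechProd_eq (x : Fin n → A) (S : Fin (k + 1) ↪o Fin n) (p : Fin (k + 1)) :
    cechProd x S = x (S p) * cechProd x (delEntry S p) :=
  Fin.prod_univ_succAbove _ p

theorem cechProd_dvd (x : Fin n → A) (S : Fin (k + 1) ↪o Fin n) (p : Fin (k + 1)) :
    cechProd x (delEntry S p) ∣ cechProd x S := ⟨x (S p), by rw [cechProd_eq x S p, mul_comm]⟩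

variable (M) in
/-- `C(x, M)^k` for `k ≥ 1`: the direct sum (finite, hence equal to the product) of the
localizations `M_{x_{S(1)} ⋯ x_{S(k)}}` over the strictly increasing sequences
`1 ≤ S(1) < ⋯ < S(k) ≤ n`. -/
abbrev CechTerm (x : Fin n → A) (k : ℕ) : Type _ :=
  ∀ S : Fin k ↪o Fin n, LocalizedModule (Submonoid.powers (cechProd x S)) M

variable (M) in
/-- The map `M → C(x, M)^1` given by the natural maps `M → M_{x_i}`. -/
noncomputable def cechD₀ (x : Fin n → A) : M →ₗ[A] CechTerm M x 1 :=
  LinearMap.pi fun _ => LocalizedModule.mkLinearMap _ M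

variable (M) in
/-- The differential `C(x, M)^(k+1) → C(x, M)^(k+2)`: its component from `S` with the `p`-th entry
deleted to `S` is `(-1)^p` (with `p` counted from `0`) times the natural map. -/
noncomputable def cechD (x : Fin n → A) (k : ℕ) :
    CechTerm M x (k + 1) →ₗ[A] CechTerm M x (k + 2) :=
  LinearMap.pi fun S => ∑ p : Fin (k + 2),
    (-1 : A) ^ (p : ℕ) • (awayMap M (cechProd_dvd x S p) ∘ₗ LinearMap.proj (delEntry S p))

theorem cechD_apply (x : Fin n → A) (c : CechTerm M x (k + 1)) (S : Fin (k + 2) ↪o Fin n) :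
    cechD M x k c S = ∑ p : Fin (k + 2),
      (-1 : A) ^ (p : ℕ) • awayMap M (cechProd_dvd x S p) (c (delEntry S p)) := by
  simp [cechD]

theorem cechD_cechD₀ (x : Fin n → A) (m : M) : cechD M x 0 (cechD₀ M x m) = 0 := by
  ext S
  rw [cechD_apply]
  have h : ∀ p, awayMap M (cechProd_dvd x S p) (cechD₀ M x m (delEntry S p)) =
      LocalizedModule.mkLinearMap _ M m := fun p =>
    LinearMap.congr_fun (awayMap_comp_mk (cechProd_dvd x S p)) m
  rw [Fin.sum_univ_two, h, h]
  simp

theorem awayMap_congr (x : Fin n → A) (c : CechTerm M x k) {S T : Fin k ↪o Fin n} (e : S = T)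
    {b : A} (h : cechProd x S ∣ b) (h' : cechProd x T ∣ b) :
    awayMap M h (c S) = awayMap M h' (c T) := by subst e; rfl

theorem delEntry_delEntry (S : Fin (k + 2) ↪o Fin n) (p : Fin (k + 2)) (q : Fin (k + 1)) :
    delEntry (delEntry S (p.succAbove q)) (q.predAbove p) = delEntry (delEntry S p) q := by
  ext r
  simp only [delEntry, RelEmbedding.coe_trans, Function.comp_apply,
    Fin.succAboveOrderEmb_apply, Fin.succAbove_succAbove_succAbove_predAbove]

theorem cechD_cechD (x : Fin n → A) (c : CechTerm M x (k + 1)) :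
    cechD M x (k + 1) (cechD M x k c) = 0 := by
  ext S
  simp only [cechD_apply, map_sum, map_smul, Finset.smul_sum, smul_smul, awayMap_awayMap,
    ← pow_add, Pi.zero_apply]
  rw [← Finset.sum_product']
  refine Finset.sum_involution (fun pq _ => (pq.1.succAbove pq.2, pq.2.predAbove pq.1)) ?_ ?_ ?_ ?_
  · rintro ⟨p, q⟩ _
    simp only [Fin.neg_one_pow_succAbove_add_predAbove, neg_smul]
    rw [awayMap_congr x c (delEntry_delEntry S p q) _
      ((cechProd_dvd x _ q).trans (cechProd_dvd x S p)), add_neg_cancel]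
  · rintro ⟨p, q⟩ _ _ h
    exact Fin.succAbove_ne p q (congrArg Prod.fst h)
  · intros; simp
  · rintro ⟨p, q⟩ _
    simp [Fin.succAbove_succAbove_predAbove, Fin.predAbove_predAbove_succAbove]

end Cech

section CechComplex

open CategoryTheory

variable {A : Type u} [CommRing A] {n : ℕ} (x : Fin n → A)
  (M : Type u) [AddCommGroup M] [Module A M]

/-- The terms of the Čech complex, with `M` in degree `0`. -/
noncomputable def cechX : ℕ → ModuleCat.{u} A
  | 0 => ModuleCat.of A M
  | k + 1 => ModuleCat.of A (CechTerm M x (k + 1))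

/-- The differentials of the Čech complex. -/
noncomputable def cechXD : ∀ i, cechX x M i ⟶ cechX x M (i + 1)
  | 0 => ModuleCat.ofHom (cechD₀ M x)
  | k + 1 => ModuleCat.ofHom (cechD M x k)

/-- The Čech complex `C(x, M)^•`. -/
noncomputable def cechComplex : CochainComplex (ModuleCat.{u} A) ℕ :=
  CochainComplex.of (cechX x M) (cechXD x M) <| by
    rintro (_ | k)
    · exact ModuleCat.hom_ext (LinearMap.ext fun m => cechD_cechD₀ x m)
    · exact ModuleCat.hom_ext (LinearMap.ext fun c => cechD_cechD x c)

end CechComplex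

section Theta

variable {A : Type*} [CommRing A] {n : ℕ} [NeZero n] {M : Type*} [AddCommGroup M] [Module A M]

theorem mk_powVec_eq (x : Fin n → A) (k α β : ℕ) (m : M) :
    (GenFrac.mk m (powVec x k α) : GenFrac (powSet x k) M) =
      GenFrac.mk ((∏ r : Fin (k + 1), seqTerm x r) ^ β • m) (powVec x k (α + β)) := by
  have h := GenFrac.mk_expand (U := powSet x k) m (u := powVec x k α) (w := powVec x k (α + β))
    (H := diagonal fun r : Fin (k + 1) => seqTerm x r ^ β) (blockTriangular_diagonal _) (by
      ext r
      rw [mulVec_diagonal]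
      change seqTerm x r ^ β * seqTerm x r ^ α = seqTerm x r ^ (α + β)
      rw [← pow_add, add_comm β])
  rw [h, det_diagonal, Finset.prod_pow]

theorem mk_powVec_congr (x : Fin n → A) (k : ℕ) {α β γ : ℕ} {m m' : M}
    (h : (∏ r : Fin (k + 1), seqTerm x r) ^ (γ + β) • m =
      (∏ r : Fin (k + 1), seqTerm x r) ^ (γ + α) • m') :
    (GenFrac.mk m (powVec x k α) : GenFrac (powSet x k) M) = GenFrac.mk m' (powVec x k β) := by
  rw [mk_powVec_eq x k α (γ + β) m, h, mk_powVec_eq x k β (γ + α) m']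
  congr 2
  ring

theorem exponent_congr (x : Fin n → A) (k : ℕ) {a : A}
    (ha : a = ∏ r : Fin (k + 1), seqTerm x r) (p p' : M × Submonoid.powers a) (h : p ≈ p') :
    (GenFrac.mk p.1 (powVec x k p.2.2.choose) : GenFrac (powSet x k) M) =
      GenFrac.mk p'.1 (powVec x k p'.2.2.choose) := by
  obtain ⟨⟨_, γ, rfl⟩, h⟩ := h
  have hs : a ^ _ = p.2.1 := p.2.2.choose_spec
  have hs' : a ^ _ = p'.2.1 := p'.2.2.choose_spec
  refine mk_powVec_congr x k (γ := γ) ?_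
  rw [← ha, pow_add, pow_add, hs, hs', mul_smul, mul_smul]
  exact h

/-- The underlying function of `thetaTop`. -/
noncomputable def thetaFun (x : Fin n → A) (k : ℕ) {a : A}
    (ha : a = ∏ r : Fin (k + 1), seqTerm x r) (z : LocalizedModule (Submonoid.powers a) M) :
    GenFrac (powSet x k) M :=
  LocalizedModule.liftOn z (fun p => GenFrac.mk p.1 (powVec x k p.2.2.choose))
    (exponent_congr x k ha)

theorem thetaFun_fracPow (x : Fin n → A) (k : ℕ) {a : A}
    (ha : a = ∏ r : Fin (k + 1), seqTerm x r) (m : M) (α : ℕ) :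
    thetaFun x k ha (fracPow a m α) = GenFrac.mk m (powVec x k α) := by
  have hs : a ^ _ = a ^ α :=
    (⟨a ^ α, pow_mem (Submonoid.mem_powers a) α⟩ : Submonoid.powers a).2.choose_spec
  unfold thetaFun fracPow
  rw [LocalizedModule.liftOn_mk]
  refine mk_powVec_congr x k (γ := 0) ?_
  rw [← ha, zero_add, zero_add, hs]

/-- The map `M_{x_1 ⋯ x_i} → U(x)_i ^ (-i) M`, `m / (x_1 ⋯ x_i)^α ↦ m / (x_1^α, …, x_i^α)`, for
`i = k + 1`; see `thetaTop_fracPow`. -/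
noncomputable def thetaTop (M : Type*) [AddCommGroup M] [Module A M] (x : Fin n → A) (k : ℕ) {a : A}
    (ha : a = ∏ r : Fin (k + 1), seqTerm x r) :
    LocalizedModule (Submonoid.powers a) M →ₗ[A] GenFrac (powSet x k) M where
  toFun := thetaFun x k ha
  map_add' y z := by
    obtain ⟨m, α, rfl⟩ := exists_fracPow y
    obtain ⟨m', β, rfl⟩ := exists_fracPow z
    have h : fracPow a m α + fracPow a m' β = fracPow a (a ^ β • m + a ^ α • m') (α + β) := by
      unfold fracPow
      rw [LocalizedModule.mk_add_mk]
      congr 1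
      exact Subtype.ext (pow_add a α β).symm
    rw [h, thetaFun_fracPow, thetaFun_fracPow, thetaFun_fracPow, ← GenFrac.mk_add_mk_same,
      mk_powVec_eq x k α β m, mk_powVec_eq x k β α m', ha, add_comm β α]
  map_smul' r z := by
    obtain ⟨m, α, rfl⟩ := exists_fracPow z
    have h : r • fracPow a m α = fracPow a (r • m) α := LocalizedModule.smul'_mk _ _ _
    rw [h, thetaFun_fracPow, thetaFun_fracPow]
    rfl

theorem thetaTop_fracPow (x : Fin n → A) (k : ℕ) {a : A}
    (ha : a = ∏ r : Fin (k + 1), seqTerm x r) (m : M) (α : ℕ) :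
    thetaTop M x k ha (fracPow a m α) = GenFrac.mk m (powVec x k α) :=
  thetaFun_fracPow x k ha m α

theorem cechProd_initial (x : Fin n → A) {k : ℕ} (h : k + 1 ≤ n) :
    cechProd x (Fin.castLEOrderEmb h) = ∏ r : Fin (k + 1), seqTerm x r :=
  Finset.prod_congr rfl fun r _ => by
    rw [seqTerm_of_lt x (lt_of_lt_of_le r.2 h)]
    rfl

variable (M) in
/-- `θ_x^i` for `i = k + 1`: the component indexed by `(1, …, i)` is mapped by
`m / (x_1 ⋯ x_i)^α ↦ m / (x_1^α, …, x_i^α)`, all other components are mapped to `0`; and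
`θ_x^i = 0` for `i > n`. -/
noncomputable def theta (x : Fin n → A) (k : ℕ) :
    CechTerm M x (k + 1) →ₗ[A] GenFrac (powSet x k) M :=
  if h : k + 1 ≤ n then
    thetaTop M x k (cechProd_initial x h) ∘ₗ LinearMap.proj (Fin.castLEOrderEmb h)
  else 0

theorem theta_of_le (x : Fin n → A) {k : ℕ} (h : k + 1 ≤ n) (c : CechTerm M x (k + 1)) :
    theta M x k c = thetaTop M x k (cechProd_initial x h) (c (Fin.castLEOrderEmb h)) := by
  simp [theta, h]

theorem theta_of_lt (x : Fin n → A) {k : ℕ} (h : n < k + 1) (c : CechTerm M x (k + 1)) :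
    theta M x k c = 0 := by
  simp [theta, not_le.2 h]

theorem theta_cechD₀ (x : Fin n → A) (m : M) :
    theta M x 0 (cechD₀ M x m) = GenFrac.mkHom (powVec x 0 0) m := by
  rw [theta_of_le x (NeZero.pos n)]
  refine Eq.trans ?_ (thetaTop_fracPow x 0 (cechProd_initial x (NeZero.pos n)) m 0)
  congr 1
  change LocalizedModule.mk m 1 = LocalizedModule.mk m _
  congr 1
  exact Subtype.ext (pow_zero _).symm

theorem thetaTop_awayMap_last (x : Fin n → A) (k : ℕ) {a b : A}
    (ha : a = ∏ r : Fin (k + 1), seqTerm x r) (hb : b = ∏ r : Fin (k + 2), seqTerm x r)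
    (h : a ∣ b) (z : LocalizedModule (Submonoid.powers a) M) :
    thetaTop M x (k + 1) hb (awayMap M h z) =
      GenFrac.appendOne _ _ (snoc_mem_powSet x k) (thetaTop M x k ha z) := by
  obtain ⟨m, α, rfl⟩ := exists_fracPow z
  have e : b = seqTerm x (k + 1) * a := by
    rw [ha, hb, Fin.prod_univ_castSucc, mul_comm]; rfl
  rw [awayMap_fracPow h e, thetaTop_fracPow, thetaTop_fracPow, GenFrac.appendOne_mk]
  symm
  have h2 := GenFrac.mk_expand (U := powSet x (k + 1)) m
    (u := ⟨_, snoc_mem_powSet x k _ (powVec x k α).2⟩) (w := powVec x (k + 1) α)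
    (H := diagonal (Fin.snoc (α := fun _ => A) (fun _ => 1) (seqTerm x (k + 1) ^ α)))
    (blockTriangular_diagonal _) (by
      ext r
      rw [mulVec_diagonal]
      induction r using Fin.lastCases with
      | last => simp [powVec]
      | cast r => simp [powVec])
  rw [h2, det_diagonal, Fin.prod_univ_castSucc]
  simp

theorem thetaTop_awayMap_ne (x : Fin n → A) (k : ℕ) {a b : A}
    (hb : b = ∏ r : Fin (k + 2), seqTerm x r) (h : a ∣ b) (p : Fin (k + 1))
    (e : b = seqTerm x p * a) (z : LocalizedModule (Submonoid.powers a) M) :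
    thetaTop M x (k + 1) hb (awayMap M h z) = 0 := by
  obtain ⟨m, α, rfl⟩ := exists_fracPow z
  rw [awayMap_fracPow h e, thetaTop_fracPow]
  exact GenFrac.mk_eq_zero_of_mem (Submodule.smul_mem_smul
    (GenFrac.mem_lowIdeal (powVec x (k + 1) α).1 p) trivial)

theorem appendOne_eq_zero (x : Fin n → A) (k : ℕ) (hk : n = k + 1) (m : M) (α : ℕ) :
    GenFrac.appendOne _ _ (snoc_mem_powSet x k) (GenFrac.mk m (powVec x k α)) = 0 := by
  rw [GenFrac.appendOne_mk]
  have h2 := GenFrac.mk_expand (U := powSet x (k + 1)) m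
    (u := ⟨_, snoc_mem_powSet x k _ (powVec x k α).2⟩) (w := powVec x (k + 1) α)
    (H := diagonal (Fin.snoc (α := fun _ => A) (fun _ => 1) (seqTerm x (k + 1) ^ α)))
    (blockTriangular_diagonal _) (by
      ext r
      rw [mulVec_diagonal]
      induction r using Fin.lastCases with
      | last => simp [powVec]
      | cast r => simp [powVec])
  rw [h2, det_diagonal, Fin.prod_univ_castSucc]
  simp only [Fin.snoc_castSucc, Fin.snoc_last, Finset.prod_const_one, one_mul]
  refine GenFrac.mk_eq_zero_of_mem (Submodule.smul_mem_smul ?_ trivial)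
  have h3 := GenFrac.mem_lowIdeal (powVec x (k + 1) α).1 (Fin.last k)
  rw [seqTerm_of_ge x (r := k + 1) (s := k) (by omega) (by omega)]
  exact h3

theorem theta_cechD (x : Fin n → A) (k : ℕ) (c : CechTerm M x (k + 1)) :
    theta M x (k + 1) (cechD M x k c) =
      (-1 : A) ^ (k + 1) • GenFrac.appendOne _ _ (snoc_mem_powSet x k) (theta M x k c) := by
  rcases lt_trichotomy n (k + 1) with h | h | h
  · rw [theta_of_lt x h, theta_of_lt x (by omega), map_zero, smul_zero]
  · rw [theta_of_lt x (by omega), theta_of_le x h.ge]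
    obtain ⟨m, α, e⟩ := exists_fracPow (c (Fin.castLEOrderEmb h.ge))
    rw [e, thetaTop_fracPow, appendOne_eq_zero x k h, smul_zero]
  · have h' : k + 1 + 1 ≤ n := h
    have hS : delEntry (Fin.castLEOrderEmb h') (Fin.last (k + 1)) =
        Fin.castLEOrderEmb (Nat.le_of_succ_le h') := by
      ext r
      simp [delEntry]
    have key : ∀ (T : Fin (k + 1) ↪o Fin n) (hT : T = Fin.castLEOrderEmb (Nat.le_of_succ_le h'))
        (hd : cechProd x T ∣ cechProd x (Fin.castLEOrderEmb h')),
        thetaTop M x (k + 1) (cechProd_initial x h') (awayMap M hd (c T)) =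
          GenFrac.appendOne _ _ (snoc_mem_powSet x k) (theta M x k c) := by
      rintro _ rfl hd
      rw [theta_of_le x (Nat.le_of_succ_le h'),
        thetaTop_awayMap_last x k (cechProd_initial x (Nat.le_of_succ_le h'))]
    rw [theta_of_le x h', cechD_apply, map_sum, Fin.sum_univ_castSucc, Finset.sum_eq_zero,
      zero_add, map_smul, key _ hS]
    · rfl
    · intro p _
      rw [map_smul, thetaTop_awayMap_ne x k (cechProd_initial x h') _ p, smul_zero]
      rw [cechProd_eq x _ p.castSucc, seqTerm_of_lt x (by omega)]
      rfl

end Theta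

section Main

open CategoryTheory

variable {A : Type u} [CommRing A] {n : ℕ} [NeZero n] (x : Fin n → A)
  (M : Type u) [AddCommGroup M] [Module A M]

/-- The components of `Θ_x`. -/
noncomputable def thetaX : ∀ i, cechX x M i ⟶ genFracX x M i
  | 0 => ModuleCat.ofHom (LinearMap.id : M →ₗ[A] M)
  | k + 1 => ModuleCat.ofHom (theta M x k)

/-- The chain map `Θ_x : C(x, M)^• ⟶ C(𝔘(x), M)`. -/
noncomputable def Theta : cechComplex x M ⟶ genFracComplex x M :=
  CochainComplex.ofHom (X := cechComplex x M) (Y := genFracComplex x M) (thetaX x M) <| by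
    intro i
    change _ ≫ CochainComplex.of.d _ _ _ _ = CochainComplex.of.d _ _ _ _ ≫ _
    rw [CochainComplex.of_d, CochainComplex.of_d]
    rcases i with _ | k
    · exact ModuleCat.hom_ext (LinearMap.ext fun m => (theta_cechD₀ x m).symm)
    · exact ModuleCat.hom_ext (LinearMap.ext fun c => (theta_cechD x k c).symm)

end Main

section FilterRegular

variable {A : Type*} [CommRing A] {M : Type*} [AddCommGroup M] [Module A M]

/-- `N :_M 𝔞^∞ = {m ∈ M ∣ 𝔞^r m ⊆ N for some r ≥ 1}`. -/
def colonInfty (N : Submodule A M) (𝔞 : Ideal A) : Set M :=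
  {m | ∃ r : ℕ, 0 < r ∧ ∀ y ∈ 𝔞 ^ r, y • m ∈ N}

/-- `x_1, …, x_n` is an `𝔞`-filter regular sequence on `M`: all `x_i` lie in `𝔞` and
`(x_1, …, x_i) M :_M x_{i+1} ⊆ (x_1, …, x_i) M :_M 𝔞^∞` for all `0 ≤ i < n`. -/
def IsFilterRegular (𝔞 : Ideal A) (M : Type*) [AddCommGroup M] [Module A M] {n : ℕ}
    (x : Fin n → A) : Prop :=
  (∀ i, x i ∈ 𝔞) ∧ ∀ i : Fin n,
    {m : M | x i • m ∈ Ideal.span (x '' {t | t < i}) • (⊤ : Submodule A M)} ⊆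
      colonInfty (Ideal.span (x '' {t | t < i}) • (⊤ : Submodule A M)) 𝔞

end FilterRegular

end

/-! Index from 0, put y = `seqTerm x` and [j] = {0,…,j-1}, let M_S be the localization of M at
∏_{i∈S} y_i, and call S ∖ {i} a face of S.

Up to powers of diagonal matrices every denominator in U(x)_{k+1} is (y_0^α,…,y_k^α). Hence M_[k+1]
maps onto the module of generalized fractions (`thetaAt_surjective`), and everything killed comes
from the faces [k+1] ∖ {i} with i < k (`mem_faceSum_of_thetaAt_eq_zero`); the face lacking the last
index k is not among them. The differential becomes the localization M_[k+1] → M_[k+2]. So for j ≥ 1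
a class of degree j in C(𝔘(x), M) is given by some z in M_[j] whose image in M_[j+1] comes from the
faces [j+1] ∖ {i}, i < j, and it is trivial when z comes from the faces of [j].

For 0 < j < n the theorem therefore says that evaluating Čech cocycles at the component [j]
identifies Čech cohomology with this subquotient: each such z extends to a cocycle
(`exists_cocycle`), and a cocycle whose component at [j] comes from the faces is a coboundary
(`exists_coboundary`). In degree n every cochain is a cocycle, above n both complexes vanish, and
degree 0 is again `exists_cocycle`.

Both facts rest on `exists_partialD_eq_of_vanishing`: a cocycle of degree at most j that vanishes on
the subsets of [j] is a coboundary. Filter the index sets by [j] ⊆ [j+1] ⊆ … ⊆ [n]. The layer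
between [m] and [m+1] consists of the sets R ∪ {m}, R ⊆ [m], and carries the Čech complex of M_{y_m}
with respect to y_0,…,y_{m-1}. Inverting y_m turns a filter regular sequence into a weakly regular
one, so this layer has cohomology only in its top degree (`exists_partialD_eq`); the top set has m +
1 > j elements and does not interfere.

Exactness of a layer is an induction over mapping cones. Its one arithmetic input is
`IsFilterSeq.mem_faceSum`: inverting one more y_q is injective on the top cohomology, because y_q is
regular modulo powers of its predecessors once a later y_r is inverted. -/

/-! ### Powers of weakly regular sequences -/

section WeaklyRegularPow

open RingTheory.Sequence Function

variable {A : Type*} [CommRing A]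

/-- Weak regularity is inherited by extensions. -/
theorem isWeaklyRegular_of_exact {N₁ N₂ N₃ : Type*} [AddCommGroup N₁] [Module A N₁]
    [AddCommGroup N₂] [Module A N₂] [AddCommGroup N₃] [Module A N₃]
    {rs : List A} {f : N₁ →ₗ[A] N₂} {g : N₂ →ₗ[A] N₃} (hf : Injective f) (hfg : Exact f g)
    (hg : Surjective g) (h₁ : IsWeaklyRegular N₁ rs) (h₃ : IsWeaklyRegular N₃ rs) :
    IsWeaklyRegular N₂ rs := by
  induction h₃ generalizing N₁ N₂ with
  | nil => exact IsWeaklyRegular.nil _ _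
  | cons r rs hr _ ih =>
    rw [isWeaklyRegular_cons_iff] at h₁ ⊢
    refine ⟨isSMulRegular_of_range_eq_ker hf (LinearMap.exact_iff.1 hfg).symm h₁.1 hr,
      ih (f := QuotSMulTop.map r f) (g := QuotSMulTop.map r g) ?_
        (QuotSMulTop.map_exact r hfg hg) (QuotSMulTop.map_surjective r hg) h₁.2⟩
    -- Injectivity of f is exactness of 0 → N₁ → N₂ at N₁; it survives reduction modulo r because r
    -- is regular on N₃.
    have h0 : Exact (0 : N₁ →ₗ[A] N₁) f := by
      rw [LinearMap.exact_iff, LinearMap.ker_eq_bot.2 hf, LinearMap.range_zero]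
    have h := QuotSMulTop.map_first_exact_on_four_term_exact_of_isSMulRegular_last h0 hfg hr
    rw [map_zero] at h
    rw [← LinearMap.ker_eq_bot, LinearMap.exact_iff.1 h, LinearMap.range_zero]

/-- Since r is regular on N, multiplication by r gives exact sequences 0 → N/r^α N → N/r^(α+1) N →
N/rN → 0, and weak regularity passes to extensions. Starting at α = 0, where the quotient is zero,
avoids a separate first step. -/
theorem isWeaklyRegular_quotSMulTop_pow {N : Type*} [AddCommGroup N] [Module A N] {r : A}
    {rs : List A} (h : IsWeaklyRegular N (r :: rs)) (α : ℕ) :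
    IsWeaklyRegular (QuotSMulTop (r ^ α) N) rs := by
  rw [isWeaklyRegular_cons_iff] at h
  induction α with
  | zero =>
    have : Subsingleton (QuotSMulTop (r ^ 0) N) := by
      rw [pow_zero]
      exact Submodule.Quotient.subsingleton_iff.2 (by ext; simp)
    refine ⟨fun i hi => ?_⟩
    have : Subsingleton (QuotSMulTop (r ^ 0) N ⧸
      (Ideal.ofList (rs.take i) • ⊤ : Submodule A (QuotSMulTop (r ^ 0) N))) :=
      (Submodule.mkQ_surjective _).subsingleton
    exact Function.injective_of_subsingleton _
  | succ α ih =>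
    let f : QuotSMulTop (r ^ α) N →ₗ[A] QuotSMulTop (r ^ (α + 1)) N :=
      Submodule.mapQ _ _ (LinearMap.lsmul A N r) (by
        rintro _ ⟨m, -, rfl⟩
        exact ⟨m, trivial, by simp [pow_succ, mul_smul]⟩)
    let g : QuotSMulTop (r ^ (α + 1)) N →ₗ[A] QuotSMulTop r N :=
      Submodule.mapQ _ _ LinearMap.id (by
        rintro _ ⟨m, -, rfl⟩
        exact ⟨r ^ α • m, trivial, by simp [pow_succ, mul_smul]⟩)
    refine isWeaklyRegular_of_exact (f := f) (g := g) ?_ ?_ ?_ ih h.2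
    · rw [← LinearMap.ker_eq_bot, LinearMap.ker_eq_bot']
      intro z hz
      obtain ⟨m, rfl⟩ := Submodule.mkQ_surjective _ z
      obtain ⟨m', -, e⟩ := (Submodule.Quotient.mk_eq_zero _).1 hz
      refine (Submodule.Quotient.mk_eq_zero _).2 ⟨m', trivial, h.1 ?_⟩
      simpa [pow_succ', mul_smul] using e
    · intro z
      obtain ⟨m, rfl⟩ := Submodule.mkQ_surjective _ z
      constructor
      · intro hz
        obtain ⟨m', -, e⟩ := (Submodule.Quotient.mk_eq_zero _).1 hz
        exact ⟨Submodule.mkQ _ m', congrArg (Submodule.mkQ _) e⟩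
      · rintro ⟨z', hz'⟩
        obtain ⟨m', rfl⟩ := Submodule.mkQ_surjective _ z'
        rw [← hz']
        exact (Submodule.Quotient.mk_eq_zero _).2 ⟨m', trivial, rfl⟩
    · intro z
      obtain ⟨m, rfl⟩ := Submodule.mkQ_surjective _ z
      exact ⟨Submodule.mkQ _ m, rfl⟩

/-- The terms of an initial segment of a weakly regular sequence may be raised to a power. -/
theorem isWeaklyRegular_map_pow_append {N : Type*} [AddCommGroup N] [Module A N] {rs ss : List A}
    (h : IsWeaklyRegular N (rs ++ ss)) (α : ℕ) :
    IsWeaklyRegular N (rs.map (· ^ α) ++ ss) := by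
  induction rs generalizing N with
  | nil => exact h
  | cons r rs ih =>
    rw [List.map_cons, List.cons_append, isWeaklyRegular_cons_iff]
    exact ⟨((isWeaklyRegular_cons_iff _ _ _).1 h).1.pow α, ih (isWeaklyRegular_quotSMulTop_pow h α)⟩

end WeaklyRegularPow

/-! ### Quasi-isomorphisms tested on elements -/

section ElementwiseQuasiIso

open CategoryTheory

variable {A : Type u} [CommRing A]

/-- A morphism of short complexes of modules is a quasi-isomorphism as soon as it is injective and
surjective on homology classes. -/
theorem shortComplex_quasiIso_of_forall {S T : ShortComplex (ModuleCat.{u} A)} (φ : S ⟶ T)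
    (inj : ∀ c : S.X₂, S.g.hom c = 0 → ∀ y : T.X₁, φ.τ₂.hom c = T.f.hom y → ∃ b, S.f.hom b = c)
    (surj : ∀ z : T.X₂, T.g.hom z = 0 →
      ∃ c : S.X₂, S.g.hom c = 0 ∧ ∃ y : T.X₁, φ.τ₂.hom c + T.f.hom y = z) :
    ShortComplex.QuasiIso φ := by
  let γ : ShortComplex.LeftHomologyMapData φ S.moduleCatLeftHomologyData
    T.moduleCatLeftHomologyData := default
  have hK (k : LinearMap.ker S.g.hom) :
      (γ.φK.hom k : LinearMap.ker T.g.hom).1 = φ.τ₂.hom k.1 :=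
    congrArg (fun f => f.hom k) γ.commi
  have hH (k : LinearMap.ker S.g.hom) :
      γ.φH.hom ((LinearMap.range S.moduleCatToCycles).mkQ k) =
        (LinearMap.range T.moduleCatToCycles).mkQ (γ.φK.hom k) :=
    congrArg (fun f => f.hom k) γ.commπ
  rw [γ.quasiIso_iff, ConcreteCategory.isIso_iff_bijective]
  constructor
  · refine (injective_iff_map_eq_zero γ.φH.hom).2 fun h hh => ?_
    obtain ⟨k, rfl⟩ := Submodule.mkQ_surjective _ h
    rw [hH] at hh
    obtain ⟨y, hy⟩ := (Submodule.Quotient.mk_eq_zero _).1 hh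
    obtain ⟨b, hb⟩ := inj k.1 k.2 y ((hK k).symm.trans (congrArg Subtype.val hy).symm)
    exact (Submodule.Quotient.mk_eq_zero _).2 ⟨b, Subtype.ext hb⟩
  · intro h
    obtain ⟨z, rfl⟩ := Submodule.mkQ_surjective _ h
    obtain ⟨c, hc, y, hy⟩ := surj z.1 z.2
    refine ⟨(LinearMap.range S.moduleCatToCycles).mkQ ⟨c, hc⟩, (hH _).trans ?_⟩
    refine ((Submodule.Quotient.eq _).2 ⟨-y, Subtype.ext ?_⟩)
    change T.f.hom (-y) = (γ.φK.hom ⟨c, hc⟩ : LinearMap.ker T.g.hom).1 - z.1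
    rw [hK, ← hy, map_neg]
    abel

end ElementwiseQuasiIso

/-! ### Fractions, filter regularity and localization -/

section PowIdeal

variable {A : Type*} [CommRing A] {M : Type*} [AddCommGroup M] [Module A M]

/-- The ideal `(y_0 ^ α, …, y_{q-1} ^ α)`. -/
def powIdeal (y : ℕ → A) (q α : ℕ) : Ideal A := Ideal.span ((fun i => y i ^ α) '' Set.Iio q)

theorem pow_mem_powIdeal (y : ℕ → A) {q i : ℕ} (hi : i < q) (α : ℕ) : y i ^ α ∈ powIdeal y q α :=
  Ideal.subset_span ⟨i, hi, rfl⟩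

theorem ofList_map_range (y : ℕ → A) (q : ℕ) :
    Ideal.ofList ((List.range q).map y) = Ideal.span (y '' Set.Iio q) := by
  refine congrArg Ideal.span (Set.ext fun a => ?_)
  simp

theorem fracPow_eq_iff {a : A} {m m' : M} {α β : ℕ} :
    fracPow a m α = fracPow a m' β ↔ ∃ γ, a ^ (γ + β) • m = a ^ (γ + α) • m' := by
  unfold fracPow
  rw [LocalizedModule.mk_eq]
  constructor
  · rintro ⟨⟨_, γ, rfl⟩, h⟩
    refine ⟨γ, ?_⟩
    rw [pow_add, pow_add, mul_smul, mul_smul]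
    exact h
  · rintro ⟨γ, h⟩
    refine ⟨⟨a ^ γ, γ, rfl⟩, ?_⟩
    rw [pow_add, pow_add, mul_smul, mul_smul] at h
    exact h

theorem fracPow_expand (a : A) (m : M) (α β : ℕ) :
    fracPow a m α = fracPow a (a ^ β • m) (α + β) :=
  fracPow_eq_iff.2 ⟨0, by rw [smul_smul, ← pow_add]; congr 2; ring⟩

theorem smul_fracPow (a r : A) (m : M) (α : ℕ) : r • fracPow a m α = fracPow a (r • m) α :=
  LocalizedModule.smul'_mk _ _ _

theorem fracPow_add_same (a : A) (m m' : M) (α : ℕ) :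
    fracPow a m α + fracPow a m' α = fracPow a (m + m') α := by
  unfold fracPow
  rw [LocalizedModule.mk_add_mk, LocalizedModule.mk_eq]
  exact ⟨1, by simp only [one_smul, smul_add, mul_smul]⟩

theorem fracPow_zero (a : A) (α : ℕ) : fracPow a (0 : M) α = 0 := LocalizedModule.zero_mk _

/-- `m ↦ m / a ^ α` as a linear map. -/
noncomputable def fracPowHom (a : A) (α : ℕ) : M →ₗ[A] LocalizedModule (Submonoid.powers a) M where
  toFun m := fracPow a m α
  map_add' m m' := (fracPow_add_same a m m' α).symm
  map_smul' r m := (smul_fracPow a r m α).symm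

theorem map_mem_smul_top {N : Type*} [AddCommGroup N] [Module A N] (f : M →ₗ[A] N) {I : Ideal A}
    {m : M} (h : m ∈ I • (⊤ : Submodule A M)) : f m ∈ I • (⊤ : Submodule A N) := by
  have h1 := Submodule.mem_map_of_mem (f := f) h
  rw [Submodule.map_smul''] at h1
  exact Submodule.smul_mono le_rfl le_top h1

/-- An element of I M_a is a finite sum of fractions with numerators in IM; a common denominator
leaves a single one. -/
theorem fracPow_mem_smul_top_iff {a : A} {I : Ideal A} {m : M} {α : ℕ} :
    fracPow a m α ∈ I • (⊤ : Submodule A (LocalizedModule (Submonoid.powers a) M)) ↔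
      ∃ β, a ^ β • m ∈ I • (⊤ : Submodule A M) := by
  constructor
  · intro h
    have key : ∃ m' ∈ I • (⊤ : Submodule A M), ∃ β, fracPow a m α = fracPow a m' β := by
      generalize fracPow a m α = z₀ at h ⊢
      induction h using Submodule.smul_induction_on' with
      | smul r hr z _ =>
        obtain ⟨m', β, rfl⟩ := exists_fracPow z
        exact ⟨r • m', Submodule.smul_mem_smul hr trivial, β, smul_fracPow _ _ _ _⟩
      | add z _ z' _ h h' =>
        obtain ⟨m₁, h₁, β₁, rfl⟩ := h
        obtain ⟨m₂, h₂, β₂, rfl⟩ := h'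
        refine ⟨_, Submodule.add_mem _ (Submodule.smul_mem _ (a ^ β₂) h₁)
          (Submodule.smul_mem _ (a ^ β₁) h₂), β₁ + β₂, ?_⟩
        rw [fracPow_expand a m₁ β₁ β₂, fracPow_expand a m₂ β₂ β₁, add_comm β₂, fracPow_add_same]
    obtain ⟨m', hm', β, e⟩ := key
    obtain ⟨γ, e⟩ := fracPow_eq_iff.1 e
    exact ⟨γ + β, e ▸ Submodule.smul_mem _ _ hm'⟩
  · rintro ⟨β, h⟩
    rw [fracPow_expand a m α β]
    exact map_mem_smul_top (fracPowHom a (α + β)) h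

variable (M) in
/-- Every `m` with `y_i m ∈ (y_0, …, y_{i-1}) M` is carried into `(y_0, …, y_{i-1}) M` by a power
of every `y_r`, for `i, r < n`. -/
def IsFilterSeq (y : ℕ → A) (n : ℕ) : Prop :=
  ∀ i < n, ∀ r < n, ∀ m : M, y i • m ∈ Ideal.span (y '' Set.Iio i) • (⊤ : Submodule A M) →
    ∃ N, y r ^ N • m ∈ Ideal.span (y '' Set.Iio i) • (⊤ : Submodule A M)

/-- Filter regularity makes the obstruction to regularity torsion with respect to each y_r, so it
disappears once y_r is inverted. -/
theorem IsFilterSeq.isWeaklyRegular {y : ℕ → A} {n : ℕ} (hy : IsFilterSeq M y n) {r k : ℕ}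
    (hr : r < n) (hk : k ≤ n) :
    RingTheory.Sequence.IsWeaklyRegular (LocalizedModule (Submonoid.powers (y r)) M)
      ((List.range k).map y) := by
  refine ⟨fun i hi => ?_⟩
  have hi' : i < k := by simpa using hi
  rw [isSMulRegular_quotient_iff_mem_of_smul_mem, ← List.map_take, List.take_range,
    min_eq_left hi'.le, ofList_map_range]
  intro z hz
  obtain ⟨m, α, rfl⟩ := exists_fracPow z
  rw [smul_fracPow, fracPow_mem_smul_top_iff] at hz
  obtain ⟨β, hβ⟩ := hz
  simp only [List.getElem_map, List.getElem_range] at hβ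
  rw [smul_comm] at hβ
  obtain ⟨N, hN⟩ := hy i (by omega) r hr _ hβ
  rw [smul_smul, ← pow_add] at hN
  exact fracPow_mem_smul_top_iff.2 ⟨_, hN⟩

/-- Over M_{y_r} the sequence is weakly regular, and remains so when y_0,…,y_{q-1} are raised to the
power α; then y_q^β is regular modulo those powers. Clearing the denominator of m/1 gives the power
of y_r. -/
theorem IsFilterSeq.exists_pow_smul_mem {y : ℕ → A} {n : ℕ} (hy : IsFilterSeq M y n) {q r : ℕ}
    (hq : q < n) (hr : r < n) {α β : ℕ} {m : M}
    (h : y q ^ β • m ∈ powIdeal y q α • (⊤ : Submodule A M)) :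
    ∃ N, y r ^ N • m ∈ powIdeal y q α • (⊤ : Submodule A M) := by
  have h1 := hy.isWeaklyRegular hr (Nat.succ_le_of_lt hq)
  rw [List.range_succ, List.map_append] at h1
  have h2 := isWeaklyRegular_map_pow_append h1 α
  rw [RingTheory.Sequence.isWeaklyRegular_append_iff, List.map_map] at h2
  have h3 := h2.2
  rw [ofList_map_range, List.map_singleton,
    RingTheory.Sequence.isWeaklyRegular_singleton_iff] at h3
  have h4 := (isSMulRegular_quotient_iff_mem_of_smul_mem _ _).1 (h3.pow β) (fracPow (y r) m 0)
    (by rw [smul_fracPow, fracPow_mem_smul_top_iff]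
        exact ⟨0, by rw [pow_zero, one_smul]; exact h⟩)
  exact fracPow_mem_smul_top_iff.1 h4

end PowIdeal

/-! ### Localizations indexed by finite sets and the images of their faces -/

section LocalizationSystem

variable {A : Type*} [CommRing A] (y : ℕ → A) (M : Type*) [AddCommGroup M] [Module A M]

/-- The localization of `M` at the product of the `y_i`, `i ∈ S`. -/
abbrev LocAt (S : Finset ℕ) : Type _ := LocalizedModule (Submonoid.powers (∏ i ∈ S, y i)) M

/-- The natural map between the localizations at `S ⊆ T`. -/
noncomputable def locMap {S T : Finset ℕ} (h : S ⊆ T) : LocAt y M S →ₗ[A] LocAt y M T :=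
  awayMap M (Finset.prod_dvd_prod_of_subset _ _ _ h)

variable {y M}

theorem locMap_locMap {S T U : Finset ℕ} (h : S ⊆ T) (h' : T ⊆ U) (z : LocAt y M S) :
    locMap y M h' (locMap y M h z) = locMap y M (h.trans h') z := awayMap_awayMap _ _ _

theorem awayMap_self {a : A} (h : a ∣ a) (z : LocalizedModule (Submonoid.powers a) M) :
    awayMap M h z = z := by
  obtain ⟨m, α, rfl⟩ := exists_fracPow z
  rw [awayMap_fracPow h (one_mul a).symm, one_pow, one_smul]

theorem locMap_erase_fracPow {S : Finset ℕ} {i : ℕ} (hi : i ∈ S) (m : M) (α : ℕ) :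
    locMap y M (S.erase_subset i) (fracPow _ m α) = fracPow _ (y i ^ α • m) α :=
  awayMap_fracPow _ (Finset.mul_prod_erase S y hi).symm m α

variable (y M) in
/-- The sum of the images of the localizations at `S ∖ {i}`, `i < q`, in the localization at `S`. -/
noncomputable def faceSum (S : Finset ℕ) (q : ℕ) : Submodule A (LocAt y M S) :=
  ⨆ i ∈ Finset.range q, LinearMap.range (locMap y M (S.erase_subset i))

/-- For i ∈ S the product contains y_i, so its δ-th power raises the exponent of each generator
y_i^γ by δ. -/
theorem prod_pow_smul_mem {S : Finset ℕ} {q : ℕ} (hS : Finset.range q ⊆ S) {γ : ℕ} (δ : ℕ) {m : M}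
    (h : m ∈ powIdeal y q γ • (⊤ : Submodule A M)) :
    (∏ i ∈ S, y i) ^ δ • m ∈ powIdeal y q (γ + δ) • (⊤ : Submodule A M) := by
  induction h using Submodule.smul_induction_on' with
  | smul r hr n _ =>
    rw [smul_smul]
    refine Submodule.smul_mem_smul ?_ trivial
    have key : powIdeal y q γ ≤ Submodule.comap (LinearMap.mulLeft A ((∏ i ∈ S, y i) ^ δ))
        (powIdeal y q (γ + δ)) := by
      refine Ideal.span_le.2 ?_
      rintro _ ⟨i, hi, rfl⟩
      simp only [SetLike.mem_coe, Submodule.mem_comap, LinearMap.mulLeft_apply]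
      rw [← Finset.mul_prod_erase S y (hS (Finset.mem_range.2 hi)), mul_pow, mul_right_comm,
        ← pow_add, add_comm δ]
      exact Ideal.mul_mem_right _ _ (pow_mem_powIdeal y hi _)
    exact key hr
  | add z _ z' _ h h' => rw [smul_add]; exact Submodule.add_mem _ h h'

/-- A fraction with denominator exponent γ comes from the face S ∖ {i} when its numerator is
divisible by y_i^γ. Passing to a common denominator adds the same amount to the denominator exponent
and to the exponents of the ideal, which is why β occurs on both sides. -/
theorem mem_faceSum_iff {S : Finset ℕ} {q : ℕ} (hS : Finset.range q ⊆ S) {m : M} {α : ℕ} :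
    fracPow _ m α ∈ faceSum y M S q ↔
      ∃ β, (∏ i ∈ S, y i) ^ β • m ∈ powIdeal y q (α + β) • (⊤ : Submodule A M) := by
  constructor
  · intro h
    have key : ∃ γ, ∃ m' ∈ powIdeal y q γ • (⊤ : Submodule A M),
        (fracPow _ m α : LocAt y M S) = fracPow _ m' γ := by
      unfold faceSum at h
      generalize (fracPow _ m α : LocAt y M S) = z₀ at h ⊢
      induction h using Submodule.iSup_induction' with
      | mem i z hz =>
        by_cases hi : i ∈ Finset.range q
        · rw [iSup_pos hi] at hz
          obtain ⟨z, rfl⟩ := hz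
          obtain ⟨m', γ, rfl⟩ := exists_fracPow z
          exact ⟨γ, _, Submodule.smul_mem_smul (pow_mem_powIdeal y (Finset.mem_range.1 hi) γ)
            trivial, locMap_erase_fracPow (hS hi) m' γ⟩
        · rw [iSup_neg hi, Submodule.mem_bot] at hz
          exact ⟨0, 0, zero_mem _, by rw [hz, fracPow_zero]⟩
      | zero => exact ⟨0, 0, zero_mem _, by rw [fracPow_zero]⟩
      | add z z' _ _ h h' =>
        obtain ⟨γ₁, m₁, h₁, rfl⟩ := h
        obtain ⟨γ₂, m₂, h₂, rfl⟩ := h'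
        refine ⟨γ₁ + γ₂, _, Submodule.add_mem _ (prod_pow_smul_mem hS γ₂ h₁)
          (add_comm γ₁ γ₂ ▸ prod_pow_smul_mem hS γ₁ h₂), ?_⟩
        rw [fracPow_expand _ m₁ γ₁ γ₂, fracPow_expand _ m₂ γ₂ γ₁, add_comm γ₂, fracPow_add_same]
    obtain ⟨γ, m', hm', e⟩ := key
    obtain ⟨δ, e⟩ := fracPow_eq_iff.1 e
    refine ⟨δ + γ, ?_⟩
    rw [e]
    convert prod_pow_smul_mem hS (δ + α) hm' using 3
    ring
  · rintro ⟨β, h⟩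
    rw [fracPow_expand _ m α β]
    have h1 := Submodule.mem_map_of_mem (f := fracPowHom (M := M) (∏ i ∈ S, y i) (α + β)) h
    refine (?_ : Submodule.map _ _ ≤ faceSum y M S q) h1
    rw [Submodule.map_le_iff_le_comap, Submodule.smul_le]
    intro r hr m' _
    refine Submodule.span_induction (p := fun r _ => r • m' ∈ Submodule.comap _ _) ?_ ?_ ?_ ?_ hr
    · rintro _ ⟨i, hi, rfl⟩
      have hi' : i ∈ Finset.range q := Finset.mem_range.2 hi
      refine Submodule.mem_iSup_of_mem i (Submodule.mem_iSup_of_mem hi' ?_)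
      exact ⟨_, locMap_erase_fracPow (hS hi') m' (α + β)⟩
    · rw [zero_smul]; exact zero_mem _
    · intro r s _ _ h h'; rw [add_smul]; exact add_mem h h'
    · intro a r _ h; rw [smul_assoc]; exact Submodule.smul_mem _ _ h

/-- For a filter regular sequence, a fraction with `y_r` in the denominator, `q < r`, lies in the sum
of the images of the localizations lacking some `y_i`, `i < q`, if it does so after inverting
`y_q`. -/
theorem IsFilterSeq.mem_faceSum {n : ℕ} (hy : IsFilterSeq M y n) {q r : ℕ} (hr : r < n)
    (hqr : q < r) {S : Finset ℕ} (hS : Finset.range q ⊆ S) (hrS : r ∈ S) (hqS : q ∉ S)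
    {z : LocAt y M S}
    (h : locMap y M (S.subset_insert q) z ∈ faceSum y M (insert q S) q) :
    z ∈ faceSum y M S q := by
  obtain ⟨m, α, rfl⟩ := exists_fracPow z
  have e : locMap y M (S.subset_insert q) (fracPow _ m α) = fracPow _ (y q ^ α • m) α :=
    awayMap_fracPow _ (Finset.prod_insert hqS) m α
  rw [e, mem_faceSum_iff (hS.trans (S.subset_insert q))] at h
  obtain ⟨β, h⟩ := h
  -- All factors y_q are collected into y_q^(β+α), acting on the remaining product applied to m, so
  -- that this power can be traded for one of y_r.
  rw [Finset.prod_insert hqS, mul_pow, smul_smul, mul_right_comm, ← pow_add, mul_smul] at h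
  obtain ⟨N, hN⟩ := hy.exists_pow_smul_mem (hqr.trans hr) hr h
  refine (mem_faceSum_iff hS).2 ⟨β + N, ?_⟩
  -- Multiplying by the N-th power of the product over S ∖ {r} completes y_r^N to the full product
  -- over S and raises the ideal exponents by N.
  have h1 : Finset.range q ⊆ S.erase r := fun i hi =>
    Finset.mem_erase.2 ⟨by have := Finset.mem_range.1 hi; omega, hS hi⟩
  have h2 := prod_pow_smul_mem h1 N hN
  rwa [smul_smul, ← mul_pow, mul_comm (∏ i ∈ S.erase r, y i), Finset.mul_prod_erase S y hrS,
    smul_smul, ← pow_add, add_comm N, add_assoc] at h2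

end LocalizationSystem

/-! ### Čech cochains on finite index sets and exactness of the layers -/

section Cochains

variable {A : Type*} [CommRing A] {y : ℕ → A} {M : Type*} [AddCommGroup M] [Module A M]

variable (y M) in
/-- Families of elements of the localizations at all finite sets of indices. -/
abbrev Cochain : Type _ := ∀ S : Finset ℕ, LocAt y M S

/-- The sign with which the face `S ∖ {i}` occurs in the Čech differential at `S`. -/
def faceSign (A : Type*) [CommRing A] (S : Finset ℕ) (i : ℕ) : A := (-1) ^ (S.filter (· < i)).card

theorem faceSign_mul_self (S : Finset ℕ) (i : ℕ) : faceSign A S i * faceSign A S i = 1 := by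
  rw [faceSign, ← mul_pow]; simp

variable (y M) in
/-- The part of the Čech differential that removes indices below `q`. -/
noncomputable def partialD (q : ℕ) : Cochain y M →ₗ[A] Cochain y M :=
  LinearMap.pi fun S => ∑ i ∈ S.filter (· < q),
    faceSign A S i • (locMap y M (S.erase_subset i) ∘ₗ LinearMap.proj (S.erase i))

theorem partialD_apply (q : ℕ) (c : Cochain y M) (S : Finset ℕ) :
    partialD y M q c S = ∑ i ∈ S.filter (· < q),
      faceSign A S i • locMap y M (S.erase_subset i) (c (S.erase i)) := by
  simp [partialD]

theorem locMap_congr (c : Cochain y M) {R R' S : Finset ℕ} (e : R = R') (h : R ⊆ S) (h' : R' ⊆ S) :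
    locMap y M h (c R) = locMap y M h' (c R') := by subst e; rfl

theorem partialD_congr {q : ℕ} {c c' : Cochain y M} {S : Finset ℕ}
    (h : ∀ i ∈ S, i < q → c (S.erase i) = c' (S.erase i)) :
    partialD y M q c S = partialD y M q c' S := by
  rw [partialD_apply, partialD_apply]
  refine Finset.sum_congr rfl fun i hi => ?_
  rw [Finset.mem_filter] at hi
  rw [h i hi.1 hi.2]

theorem partialD_eq_zero {q : ℕ} {c : Cochain y M} {S : Finset ℕ}
    (h : ∀ i ∈ S, i < q → c (S.erase i) = 0) : partialD y M q c S = 0 := by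
  rw [partialD_congr (c' := 0) h, map_zero]; rfl

theorem partialD_eq_of_subset {q q' : ℕ} (c : Cochain y M) {S : Finset ℕ}
    (h : S ⊆ Finset.range q) (h' : S ⊆ Finset.range q') :
    partialD y M q c S = partialD y M q' c S := by
  rw [partialD_apply, partialD_apply, Finset.filter_true_of_mem fun i hi => Finset.mem_range.1 (h hi),
    Finset.filter_true_of_mem fun i hi => Finset.mem_range.1 (h' hi)]

theorem partialD_succ_of_notMem {q : ℕ} (c : Cochain y M) {S : Finset ℕ} (h : q ∉ S) :
    partialD y M (q + 1) c S = partialD y M q c S := by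
  rw [partialD_apply, partialD_apply]
  congr 1
  refine Finset.filter_congr fun i hi => ?_
  have : i ≠ q := fun e => h (e ▸ hi)
  omega

/-- Together with the case q ∉ S, this exhibits the differential for q + 1 as that of a mapping
cone: the differentials for q on the sets with and without q, joined by the localization at y_q. -/
theorem partialD_succ_of_mem {q : ℕ} (c : Cochain y M) {S : Finset ℕ} (h : q ∈ S) :
    partialD y M (q + 1) c S = partialD y M q c S +
      faceSign A S q • locMap y M (S.erase_subset q) (c (S.erase q)) := by
  rw [partialD_apply, partialD_apply]
  have : S.filter (· < q + 1) = insert q (S.filter (· < q)) := by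
    ext i
    simp only [Finset.mem_filter, Finset.mem_insert]
    constructor
    · rintro ⟨h1, h2⟩
      rcases Nat.lt_succ_iff_lt_or_eq.1 h2 with h3 | h3
      · exact Or.inr ⟨h1, h3⟩
      · exact Or.inl h3
    · rintro (rfl | ⟨h1, h2⟩)
      · exact ⟨h, Nat.lt_succ_self _⟩
      · exact ⟨h1, by omega⟩
  rw [this, Finset.sum_insert (by simp), add_comm]

/-- Deleting the smaller index shifts the position of the larger by one; deleting the larger leaves
the position of the smaller unchanged. -/
theorem faceSign_mul_faceSign_erase {S : Finset ℕ} {i j : ℕ} (hi : i ∈ S) (hj : j ∈ S)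
    (hij : i ≠ j) :
    faceSign A S i * faceSign A (S.erase i) j = -(faceSign A S j * faceSign A (S.erase j) i) := by
  have key : ∀ {i j : ℕ}, i ∈ S → i < j →
      faceSign A S i * faceSign A (S.erase i) j = -(faceSign A S j * faceSign A (S.erase j) i) := by
    intro i j hi hij
    have h1 : (S.filter (· < j)).card = ((S.erase i).filter (· < j)).card + 1 := by
      rw [Finset.filter_erase, Finset.card_erase_add_one (Finset.mem_filter.2 ⟨hi, hij⟩)]
    have h2 : (S.erase j).filter (· < i) = S.filter (· < i) := by
      ext k
      simp only [Finset.mem_filter, Finset.mem_erase]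
      constructor
      · rintro ⟨⟨_, h⟩, h'⟩; exact ⟨h, h'⟩
      · rintro ⟨h, h'⟩; exact ⟨⟨by omega, h⟩, h'⟩
    unfold faceSign
    rw [h1, h2]
    ring
  rcases lt_or_gt_of_ne hij with h | h
  · exact key hi h
  · rw [key hj h, neg_neg]

theorem partialD_partialD (q : ℕ) (c : Cochain y M) : partialD y M q (partialD y M q c) = 0 := by
  ext S
  rw [partialD_apply]
  simp only [partialD_apply, map_sum, map_smul, Finset.smul_sum, smul_smul, locMap_locMap,
    Pi.zero_apply]
  rw [Finset.sum_sigma']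
  refine Finset.sum_involution (fun p _ => ⟨p.2, p.1⟩) ?_ ?_ ?_ ?_
  · rintro ⟨i, j⟩ h
    simp only [Finset.mem_sigma, Finset.mem_filter, Finset.mem_erase] at h
    obtain ⟨⟨hi, _⟩, ⟨hji, hj⟩, _⟩ := h
    simp only
    rw [locMap_congr c Finset.erase_right_comm _
      (((S.erase j).erase_subset i).trans (S.erase_subset j)),
      faceSign_mul_faceSign_erase hi hj (Ne.symm hji), neg_smul, neg_add_cancel]
  · rintro ⟨i, j⟩ h _ e
    simp only [Finset.mem_sigma, Finset.mem_filter, Finset.mem_erase] at h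
    exact h.2.1.1 (congrArg Sigma.fst e)
  · rintro ⟨i, j⟩ h
    simp only [Finset.mem_sigma, Finset.mem_filter, Finset.mem_erase] at h ⊢
    obtain ⟨⟨hi, hiq⟩, ⟨hji, hj⟩, hjq⟩ := h
    exact ⟨⟨hj, hjq⟩, ⟨hji.symm, hi⟩, hiq⟩
  · rintro ⟨i, j⟩ h
    rfl

theorem partialD_mem_faceSum (q : ℕ) (c : Cochain y M) (S : Finset ℕ) :
    partialD y M q c S ∈ faceSum y M S q := by
  rw [partialD_apply]
  refine Submodule.sum_mem _ fun i hi => Submodule.smul_mem _ _ ?_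
  exact Submodule.mem_iSup_of_mem i (Submodule.mem_iSup_of_mem
    (Finset.mem_range.2 (Finset.mem_filter.1 hi).2) ⟨_, rfl⟩)

/-- The support condition matters as much as the equation: it keeps later corrections by such a
cochain away from components already under control. -/
theorem exists_partialD_eq_of_mem_faceSum {q : ℕ} {S : Finset ℕ} (hS : Finset.range q ⊆ S)
    {z : LocAt y M S} (h : z ∈ faceSum y M S q) :
    ∃ b : Cochain y M, partialD y M q b S = z ∧
      ∀ R, (∀ i < q, R ≠ S.erase i) → b R = 0 := by
  unfold faceSum at h
  induction h using Submodule.iSup_induction' with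
  | mem i z hz =>
    by_cases hi : i ∈ Finset.range q
    · rw [iSup_pos hi] at hz
      obtain ⟨t, rfl⟩ := hz
      refine ⟨Pi.single (S.erase i) (faceSign A S i • t), ?_, fun R hR => ?_⟩
      · rw [partialD_apply, Finset.sum_eq_single i]
        · rw [Pi.single_eq_same, map_smul, smul_smul, faceSign_mul_self, one_smul]
        · intro j hj hji
          rw [Pi.single_eq_of_ne, map_zero, smul_zero]
          intro e
          have : i ∈ S.erase j := Finset.mem_erase.2 ⟨hji.symm, hS hi⟩
          rw [e] at this
          exact Finset.notMem_erase _ _ this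
        · intro h
          exact (h (Finset.mem_filter.2 ⟨hS hi, Finset.mem_range.1 hi⟩)).elim
      · exact Pi.single_eq_of_ne (hR i (Finset.mem_range.1 hi)) _
    · rw [iSup_neg hi, Submodule.mem_bot] at hz
      exact ⟨0, by rw [hz, map_zero]; rfl, fun _ _ => rfl⟩
  | zero => exact ⟨0, by rw [map_zero]; rfl, fun _ _ => rfl⟩
  | add z z' _ _ h h' =>
    obtain ⟨b, hb, hb'⟩ := h
    obtain ⟨d, hd, hd'⟩ := h'
    exact ⟨b + d, by rw [map_add, Pi.add_apply, hb, hd], fun R hR => by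
      rw [Pi.add_apply, hb' R hR, hd' R hR, add_zero]⟩

open Classical in
/-- The restriction of a cochain to a family of index sets, extended by zero. -/
noncomputable def Cochain.restrict (P : Finset ℕ → Prop) (c : Cochain y M) : Cochain y M :=
  fun S => if P S then c S else 0

theorem Cochain.restrict_of_pos {P : Finset ℕ → Prop} (c : Cochain y M) {S : Finset ℕ} (h : P S) :
    c.restrict P S = c S := if_pos h

theorem Cochain.restrict_of_neg {P : Finset ℕ → Prop} (c : Cochain y M) {S : Finset ℕ}
    (h : ¬ P S) : c.restrict P S = 0 := if_neg h

/-- The sets R ∪ T with R ⊆ [q] form a cube carrying the Čech complex of M_T with respect to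
y_0,…,y_{q-1}, and the claim is exactness below the top of the cube. The cube for q + 1 is the
mapping cone of the cube of T into that of T ∪ {q}. By induction both have only top cohomology, and
the map between these is injective by `IsFilterSeq.mem_faceSum`, so only the top of the cone
survives. The index r ∈ T supplies the inverted element that this injectivity needs. -/
theorem exists_partialD_eq {n : ℕ} (hy : IsFilterSeq M y n) (q : ℕ) :
    ∀ T : Finset ℕ, (∀ t ∈ T, q ≤ t) → (∃ r ∈ T, r < n) → ∀ c : Cochain y M,
      (∀ S, S \ Finset.range q = T → partialD y M q c S = 0) → c (Finset.range q ∪ T) = 0 →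
      ∃ b : Cochain y M, ∀ S, S \ Finset.range q = T → partialD y M q b S = c S := by
  induction q with
  | zero =>
    intro T _ _ c _ h
    refine ⟨0, fun S hS => ?_⟩
    have : S = Finset.range 0 ∪ T := by simpa using hS
    rw [this, h, map_zero]
    rfl
  | succ q ih =>
    intro T hT ⟨r, hrT, hrn⟩ c hc htop
    have hqT : q ∉ T := fun h => by have := hT q h; omega
    -- the faces of an index set with tail `T`, split according to whether `q` occurs
    have tail₀ : ∀ {S : Finset ℕ}, S \ Finset.range q = T → q ∉ S := fun h hq =>
      hqT (h ▸ Finset.mem_sdiff.2 ⟨hq, by simp⟩)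
    have tail₁ : ∀ {S : Finset ℕ}, S \ Finset.range q = insert q T → q ∈ S := fun h =>
      (Finset.mem_sdiff.1 (h ▸ Finset.mem_insert_self q T)).1
    have succ₀ : ∀ {S : Finset ℕ}, S \ Finset.range q = T → S \ Finset.range (q + 1) = T := by
      intro S h
      rw [Finset.range_add_one, Finset.sdiff_insert, h, Finset.erase_eq_of_notMem hqT]
    have succ₁ : ∀ {S : Finset ℕ}, S \ Finset.range q = insert q T →
        S \ Finset.range (q + 1) = T := by
      intro S h
      rw [Finset.range_add_one, Finset.sdiff_insert, h, Finset.erase_insert hqT]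
    have cases : ∀ {S : Finset ℕ}, S \ Finset.range (q + 1) = T →
        S \ Finset.range q = T ∨ S \ Finset.range q = insert q T := by
      intro S h
      rw [Finset.range_add_one, Finset.sdiff_insert] at h
      by_cases hq : q ∈ S \ Finset.range q
      · exact Or.inr (by rw [← h, Finset.insert_erase hq])
      · exact Or.inl (by rwa [Finset.erase_eq_of_notMem hq] at h)
    have erase_tail : ∀ {S U : Finset ℕ} {i : ℕ}, S \ Finset.range q = U → i < q →
        S.erase i \ Finset.range q = U := by
      intro S U i h hi
      rw [Finset.erase_sdiff_comm, h, Finset.erase_eq_of_notMem]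
      rw [← h]
      exact fun h' => (Finset.mem_sdiff.1 h').2 (Finset.mem_range.2 hi)
    have erase_q : ∀ {S : Finset ℕ}, S \ Finset.range q = insert q T →
        S.erase q \ Finset.range q = T := by
      intro S h
      rw [Finset.erase_sdiff_comm, h, Finset.erase_insert hqT]
    have hdisj : Disjoint T (Finset.range q) :=
      Finset.disjoint_left.2 fun t ht h => by have := hT t ht; have := Finset.mem_range.1 h; omega
    set S₀ := Finset.range q ∪ T with hS₀
    have tailS₀ : S₀ \ Finset.range q = T := by
      rw [hS₀, Finset.union_sdiff_distrib, sdiff_self, Finset.bot_eq_empty, Finset.empty_union,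
        Finset.sdiff_eq_self_of_disjoint hdisj]
    have hqS₀ : q ∉ S₀ := tail₀ tailS₀
    have hS₁ : Finset.range (q + 1) ∪ T = insert q S₀ := by
      rw [Finset.range_add_one, Finset.insert_union]
    have hS₁' : Finset.range q ∪ insert q T = insert q S₀ := Finset.union_insert _ _ _
    have tailS₁ : insert q S₀ \ Finset.range q = insert q T := by
      rw [Finset.insert_sdiff_of_notMem _ (by simp), tailS₀]
    have hrange : Finset.range q ⊆ S₀ := Finset.subset_union_left
    rw [hS₁] at htop
    -- make the component at `S₀` vanish
    have hface : c S₀ ∈ faceSum y M S₀ q := by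
      refine hy.mem_faceSum hrn (Nat.lt_of_succ_le (hT r hrT)) hrange
        (Finset.mem_union_right _ hrT) hqS₀ ?_
      -- The cocycle equation at S₀ ∪ {q} writes the image of c S₀ there as a combination of the
      -- faces lacking some i < q.
      have h1 := hc _ (succ₁ tailS₁)
      rw [partialD_succ_of_mem c (Finset.mem_insert_self q S₀), ← eq_neg_iff_add_eq_zero] at h1
      have h2 := partialD_mem_faceSum q c (insert q S₀)
      rw [h1, Submodule.neg_mem_iff, locMap_congr c (Finset.erase_insert hqS₀) _
        (S₀.subset_insert q)] at h2
      have h3 := Submodule.smul_mem _ (faceSign A (insert q S₀) q) h2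
      rwa [smul_smul, faceSign_mul_self, one_smul] at h3
    obtain ⟨b₀, hb₀, hb₀'⟩ := exists_partialD_eq_of_mem_faceSum hrange hface
    have hb₀z : ∀ R, q ∈ R → b₀ R = 0 := fun R hR => hb₀' R fun i _ e => by
      rw [e] at hR
      exact hqS₀ (Finset.mem_of_mem_erase hR)
    set c₁ := c - partialD y M (q + 1) b₀ with hc₁
    have hc₁D : ∀ S, S \ Finset.range (q + 1) = T → partialD y M (q + 1) c₁ S = 0 := by
      intro S hS
      rw [hc₁, map_sub, partialD_partialD, sub_zero, hc S hS]
    have hc₁₀ : c₁ S₀ = 0 := by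
      rw [hc₁, Pi.sub_apply, partialD_succ_of_notMem _ hqS₀, hb₀, sub_self]
    -- The top component stays zero: b₀ lives on the sets S₀ ∖ {i} with i < q, none of which is a
    -- face of S₀ ∪ {q}.
    have hc₁₁ : c₁ (insert q S₀) = 0 := by
      rw [hc₁, Pi.sub_apply, htop, partialD_eq_zero, sub_zero]
      intro i hi hiq
      by_cases h : i = q
      · subst h
        rw [Finset.erase_insert hqS₀]
        refine hb₀' _ fun j hj e => ?_
        have : j ∈ S₀ := hrange (Finset.mem_range.2 hj)
        rw [e] at this
        exact Finset.notMem_erase _ _ this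
      · exact hb₀z _ (Finset.mem_erase.2 ⟨Ne.symm h, Finset.mem_insert_self _ _⟩)
    -- the part without `q`
    obtain ⟨b₁, hb₁⟩ := ih T (fun t ht => by have := hT t ht; omega) ⟨r, hrT, hrn⟩ c₁
      (fun S hS => by rw [← partialD_succ_of_notMem c₁ (tail₀ hS)]; exact hc₁D S (succ₀ hS)) hc₁₀
    -- S₀ is left out because it is a face of the top set S₀ ∪ {q}, where nothing may be added. The
    -- equations on sets with tail T do not notice: their faces lack some i < q, while S₀ contains
    -- all of them.
    set d₁ := b₁.restrict fun S => S \ Finset.range q = T ∧ S ≠ S₀ with hd₁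
    have hd₁D : ∀ S, S \ Finset.range q = T → partialD y M (q + 1) d₁ S = c₁ S := by
      intro S hS
      rw [partialD_succ_of_notMem _ (tail₀ hS), ← hb₁ S hS]
      refine partialD_congr fun i hi hiq => Cochain.restrict_of_pos _ ⟨erase_tail hS hiq, fun e => ?_⟩
      have : i ∈ S₀ := hrange (Finset.mem_range.2 hiq)
      rw [← e] at this
      exact Finset.notMem_erase _ _ this
    set c₂ := c₁ - partialD y M (q + 1) d₁ with hc₂
    have hc₂₀ : ∀ S, S \ Finset.range q = T → c₂ S = 0 := fun S hS => by
      rw [hc₂, Pi.sub_apply, hd₁D S hS, sub_self]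
    have hc₂D : ∀ S, S \ Finset.range q = insert q T → partialD y M q c₂ S = 0 := by
      intro S hS
      have h : partialD y M (q + 1) c₂ S = 0 := by
        rw [hc₂, map_sub, partialD_partialD, sub_zero, hc₁D S (succ₁ hS)]
      rwa [partialD_succ_of_mem _ (tail₁ hS), hc₂₀ _ (erase_q hS), map_zero, smul_zero,
        add_zero] at h
    have hc₂₁ : c₂ (insert q S₀) = 0 := by
      rw [hc₂, Pi.sub_apply, hc₁₁, partialD_eq_zero, sub_zero]
      intro i hi hiq
      refine Cochain.restrict_of_neg _ ?_
      rintro ⟨h1, h2⟩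
      by_cases h : i = q
      · subst h
        exact h2 (Finset.erase_insert hqS₀)
      · exact tail₀ h1 (Finset.mem_erase.2 ⟨Ne.symm h, Finset.mem_insert_self _ _⟩)
    -- the part with `q`
    obtain ⟨b₂, hb₂⟩ := ih (insert q T)
      (fun t ht => by
        rcases Finset.mem_insert.1 ht with rfl | ht
        · exact le_rfl
        · have := hT t ht; omega)
      ⟨r, Finset.mem_insert_of_mem hrT, hrn⟩ c₂ hc₂D (by rw [hS₁', hc₂₁])
    -- Supported on sets containing q, d₂ cannot alter the components with tail T that are already
    -- solved.
    set d₂ := b₂.restrict fun S => S \ Finset.range q = insert q T with hd₂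
    have hd₂D : ∀ S, S \ Finset.range (q + 1) = T → partialD y M (q + 1) d₂ S = c₂ S := by
      intro S hS
      rcases cases hS with h | h
      · rw [hc₂₀ S h]
        refine partialD_eq_zero fun i hi hiq => Cochain.restrict_of_neg _ fun h' => ?_
        exact tail₀ h (Finset.mem_of_mem_erase (tail₁ h'))
      · have hz : d₂ (S.erase q) = 0 :=
          Cochain.restrict_of_neg _ fun h' => Finset.notMem_erase q S (tail₁ h')
        rw [partialD_succ_of_mem _ (tail₁ h), ← hb₂ S h, hz, map_zero, smul_zero, add_zero]
        exact partialD_congr fun i hi hiq => Cochain.restrict_of_pos _ (erase_tail h hiq)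
    refine ⟨b₀ + d₁ + d₂, fun S hS => ?_⟩
    rw [map_add, map_add, Pi.add_apply, Pi.add_apply, hd₂D S hS, hc₂, hc₁]
    simp only [Pi.sub_apply]
    abel

/-- A cocycle of degree at most `j` on the subsets of `{0, …, n-1}` that vanishes on the subsets of
`{0, …, j-1}` is the coboundary of a cochain of degree less than `j` with the same property. -/
theorem exists_partialD_eq_of_vanishing {n : ℕ} (hy : IsFilterSeq M y n) {j : ℕ} {e : Cochain y M}
    (h₀ : ∀ S ⊆ Finset.range j, e S = 0) (hcard : ∀ S, j < S.card → e S = 0)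
    (hD : ∀ S ⊆ Finset.range n, partialD y M n e S = 0) :
    ∀ m, j ≤ m → m ≤ n → ∃ b : Cochain y M, (∀ S ⊆ Finset.range j, b S = 0) ∧
      (∀ S, j ≤ S.card → b S = 0) ∧ ∀ S ⊆ Finset.range m, partialD y M n b S = e S := by
  intro m hjm
  induction m, hjm using Nat.le_induction with
  | base =>
    exact fun _ => ⟨0, fun _ _ => rfl, fun _ _ => rfl, fun S hS => by rw [h₀ S hS, map_zero]; rfl⟩
  | succ m hjm ih =>
    intro hmn
    obtain ⟨b, hb₀, hbcard, hb⟩ := ih (by omega)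
    set e' := e - partialD y M n b with he'
    have he'₀ : ∀ S ⊆ Finset.range m, e' S = 0 := fun S hS => by
      rw [he', Pi.sub_apply, hb S hS, sub_self]
    have hbD : ∀ S, j < S.card → partialD y M n b S = 0 := fun S hS =>
      partialD_eq_zero fun i hi _ => hbcard _ (by rw [Finset.card_erase_of_mem hi]; omega)
    have tail_mem : ∀ {S : Finset ℕ}, S \ Finset.range m = {m} → m ∈ S := fun h =>
      (Finset.mem_sdiff.1 (h ▸ Finset.mem_singleton_self m)).1
    have tail_sub : ∀ {S : Finset ℕ}, S \ Finset.range m = {m} → S.erase m ⊆ Finset.range m := by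
      intro S h
      rw [← Finset.sdiff_eq_empty_iff_subset, Finset.erase_sdiff_comm, h]
      simp
    have tail_sub' : ∀ {S : Finset ℕ}, S \ Finset.range m = {m} → S ⊆ Finset.range (m + 1) := by
      intro S h
      rw [Finset.range_add_one, ← Finset.insert_erase (tail_mem h)]
      exact Finset.insert_subset_insert _ (tail_sub h)
    have hsucc : ∀ {S : Finset ℕ} (c : Cochain y M), S ⊆ Finset.range (m + 1) →
        partialD y M n c S = partialD y M (m + 1) c S := fun c h =>
      partialD_eq_of_subset c (h.trans (Finset.range_subset_range.2 hmn)) h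
    -- The error e' is supported on the new layer among subsets of [m+1], so there it is a cocycle
    -- for the differential of that layer. Exactness applies with tail {m}, the inverted element
    -- being y_m.
    obtain ⟨b', hb'⟩ := exists_partialD_eq hy m {m} (by simp) ⟨m, by simp, hmn⟩ e'
      (by
        intro S hS
        have h : partialD y M n e' S = 0 := by
          rw [he', map_sub, partialD_partialD, sub_zero,
            hD S ((tail_sub' hS).trans (Finset.range_subset_range.2 hmn))]
        rwa [hsucc _ (tail_sub' hS), partialD_succ_of_mem _ (tail_mem hS), he'₀ _ (tail_sub hS),
          map_zero, smul_zero, add_zero] at h)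
      (by
        have h : j < (Finset.range m ∪ {m}).card := by
          rw [Finset.union_comm, ← Finset.insert_eq, ← Finset.range_add_one, Finset.card_range]
          omega
        rw [he', Pi.sub_apply, hcard _ h, hbD _ h, sub_zero])
    -- Components of b' of size at least j are discarded; they could only affect sets of size
    -- greater than j, where e and the coboundary of b already vanish.
    set d := b'.restrict fun S => S \ Finset.range m = {m} ∧ S.card < j with hd
    refine ⟨b + d, fun S hS => ?_, fun S hS => ?_, fun S hS => ?_⟩
    · rw [Pi.add_apply, hb₀ S hS, zero_add]
      refine Cochain.restrict_of_neg _ fun h => ?_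
      have := Finset.mem_range.1 (hS (tail_mem h.1))
      omega
    · rw [Pi.add_apply, hbcard S hS, zero_add]
      exact Cochain.restrict_of_neg _ fun h => by omega
    · rw [map_add, Pi.add_apply]
      by_cases hm : m ∈ S
      · have hS' : S \ Finset.range m = {m} := by
          ext i
          simp only [Finset.mem_sdiff, Finset.mem_range, Finset.mem_singleton]
          constructor
          · rintro ⟨h1, h2⟩
            have := Finset.mem_range.1 (hS h1)
            omega
          · rintro rfl
            exact ⟨hm, by omega⟩
        rcases lt_or_ge j S.card with h | h
        · rw [hcard S h, hbD S h, zero_add]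
          refine partialD_eq_zero fun i hi _ => Cochain.restrict_of_neg _ fun h' => ?_
          rw [Finset.card_erase_of_mem hi] at h'
          omega
        · have h1 : partialD y M n d S = e' S := by
            have hz : d (S.erase m) = 0 :=
              Cochain.restrict_of_neg _ fun h' => Finset.notMem_erase m S (tail_mem h'.1)
            rw [hsucc _ hS, partialD_succ_of_mem _ hm, ← hb' S hS', hz, map_zero, smul_zero,
              add_zero]
            refine partialD_congr fun i hi him => Cochain.restrict_of_pos _ ⟨?_, ?_⟩
            · rw [Finset.erase_sdiff_comm, hS', Finset.erase_eq_of_notMem]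
              simpa using him.ne
            · have := Finset.card_pos.2 ⟨i, hi⟩
              rw [Finset.card_erase_of_mem hi]
              omega
          rw [h1, he', Pi.sub_apply]
          abel
      · have h1 : S ⊆ Finset.range m := fun i hi => by
          have := Finset.mem_range.1 (hS hi)
          have : i ≠ m := fun e => hm (e ▸ hi)
          exact Finset.mem_range.2 (by omega)
        rw [hb S h1, partialD_eq_zero, add_zero]
        exact fun i _ _ => Cochain.restrict_of_neg _ fun h' =>
          hm (Finset.mem_of_mem_erase (tail_mem h'.1))

end Cochains

/-! ### Extending and trivializing cocycles from an initial component -/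

section Cocycles

variable {A : Type*} [CommRing A] {y : ℕ → A} {M : Type*} [AddCommGroup M] [Module A M]

theorem card_eq_of_eq_erase {R : Finset ℕ} {j i : ℕ} (hi : i < j + 1)
    (h : R = (Finset.range (j + 1)).erase i) : R.card = j := by
  rw [h, Finset.card_erase_of_mem (Finset.mem_range.2 hi), Finset.card_range, Nat.add_sub_cancel]

theorem eq_range_or_card_lt {S : Finset ℕ} {j : ℕ} (hS : S ⊆ Finset.range j) :
    S = Finset.range j ∨ S.card < j := by
  rcases eq_or_ne S (Finset.range j) with h | h
  · exact Or.inl h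
  · have := Finset.card_lt_card (Finset.ssubset_iff_subset_ne.2 ⟨hS, h⟩)
    rw [Finset.card_range] at this
    exact Or.inr this

/-- An element of the localization at `{0, …, j-1}` extends to a Čech cocycle of degree `j`
provided that its image in the localization at `{0, …, j}` is cancelled by the other faces. -/
theorem exists_cocycle {n : ℕ} (hy : IsFilterSeq M y n) {j : ℕ} (hj : j < n)
    {z : LocAt y M (Finset.range j)}
    (hz : locMap y M (Finset.range_subset_range.2 (Nat.le_succ j)) z ∈
      faceSum y M (Finset.range (j + 1)) j) :
    ∃ c : Cochain y M, (∀ S ⊆ Finset.range n, partialD y M n c S = 0) ∧ c (Finset.range j) = z := by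
  obtain ⟨b₀, hb₀, hb₀'⟩ := exists_partialD_eq_of_mem_faceSum
    (Finset.range_subset_range.2 (Nat.le_succ j)) hz
  have herase : (Finset.range (j + 1)).erase j = Finset.range j := by
    rw [Finset.range_add_one, Finset.erase_insert (by simp)]
  have hb₀r : b₀ (Finset.range j) = 0 := hb₀' _ fun i hi e => by
    have : i ∈ Finset.range j := Finset.mem_range.2 hi
    rw [e] at this
    exact Finset.notMem_erase _ _ this
  have hb₀c : ∀ S : Finset ℕ, S.card ≠ j → b₀ S = 0 := fun S hS =>
    hb₀' S fun i hi e => hS (card_eq_of_eq_erase (hi.trans (Nat.lt_succ_self j)) e)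
  let B : Cochain y M := Pi.single (Finset.range j) z
  have hBc : ∀ S : Finset ℕ, S.card ≠ j → B S = 0 := fun S hS =>
    Pi.single_eq_of_ne (fun e => hS (by rw [e, Finset.card_range])) _
  have hBr : B (Finset.range j) = z := Pi.single_eq_same _ _
  -- The sign makes the face [j], carrying z, cancel the faces carrying b₀ in the cocycle equation
  -- at [j+1].
  set c := B - faceSign A (Finset.range (j + 1)) j • b₀ with hc
  have hcc : ∀ S : Finset ℕ, S.card ≠ j → c S = 0 := fun S hS => by
    rw [hc, Pi.sub_apply, Pi.smul_apply, hBc S hS, hb₀c S hS, smul_zero, sub_zero]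
  have hcr : c (Finset.range j) = z := by
    rw [hc, Pi.sub_apply, Pi.smul_apply, hBr, hb₀r, smul_zero, sub_zero]
  have hDc : ∀ S : Finset ℕ, S.card ≠ j + 1 → partialD y M n c S = 0 := fun S hS =>
    partialD_eq_zero fun i hi _ => hcc _ (by
      have := Finset.card_pos.2 ⟨i, hi⟩
      rw [Finset.card_erase_of_mem hi]; omega)
  have htop : partialD y M n c (Finset.range (j + 1)) = 0 := by
    have h1 : partialD y M j B (Finset.range (j + 1)) = 0 := partialD_eq_zero fun i hi hij =>
      Pi.single_eq_of_ne (fun e => by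
        have : i ∈ Finset.range j := Finset.mem_range.2 hij
        rw [← e] at this
        exact Finset.notMem_erase _ _ this) _
    have h2 : partialD y M j c (Finset.range (j + 1)) = -(faceSign A (Finset.range (j + 1)) j •
        locMap y M (Finset.range_subset_range.2 (Nat.le_succ j)) z) := by
      rw [hc, map_sub, map_smul, Pi.sub_apply, Pi.smul_apply, hb₀, h1, zero_sub]
    rw [partialD_eq_of_subset c (Finset.range_subset_range.2 hj) subset_rfl,
      partialD_succ_of_mem c (Finset.self_mem_range_succ j), h2,
      locMap_congr c herase _ (Finset.range_subset_range.2 (Nat.le_succ j)), hcr, neg_add_cancel]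
  -- The coboundary of c lives in degree j + 1 and vanishes on every subset of [j+1], so it also
  -- bounds a cochain vanishing there; subtracting that leaves the component z intact.
  obtain ⟨b, hb, -, hbD⟩ := exists_partialD_eq_of_vanishing hy (j := j + 1) (e := partialD y M n c)
    (fun S hS => by
      rcases eq_range_or_card_lt hS with rfl | h
      · exact htop
      · exact hDc S h.ne)
    (fun S hS => hDc S hS.ne') (fun S _ => by rw [partialD_partialD]; rfl) n hj le_rfl
  refine ⟨c - b, fun S hS => ?_, ?_⟩
  · rw [map_sub, Pi.sub_apply, hbD S hS, sub_self]
  · rw [Pi.sub_apply, hcr, hb _ (Finset.range_subset_range.2 (Nat.le_succ j)), sub_zero]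

/-- A Čech cocycle of degree `j` whose component at `{0, …, j-1}` comes from its faces is a
coboundary. -/
theorem exists_coboundary {n : ℕ} (hy : IsFilterSeq M y n) {j : ℕ} (hj : j + 1 ≤ n)
    {c : Cochain y M} (hc : ∀ S ⊆ Finset.range n, partialD y M n c S = 0)
    (hcard : ∀ S, S.card ≠ j + 1 → c S = 0)
    (htop : c (Finset.range (j + 1)) ∈ faceSum y M (Finset.range (j + 1)) (j + 1)) :
    ∃ b : Cochain y M, ∀ S ⊆ Finset.range n, partialD y M n b S = c S := by
  obtain ⟨b₀, hb₀, hb₀'⟩ := exists_partialD_eq_of_mem_faceSum subset_rfl htop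
  have hb₀c : ∀ S : Finset ℕ, S.card ≠ j → b₀ S = 0 := fun S hS =>
    hb₀' S fun i hi e => hS (card_eq_of_eq_erase hi e)
  have hD : ∀ S : Finset ℕ, S.card ≠ j + 1 → (c - partialD y M n b₀) S = 0 := fun S hS => by
    rw [Pi.sub_apply, hcard S hS, partialD_eq_zero, sub_zero]
    intro i hi _
    refine hb₀c _ ?_
    have := Finset.card_pos.2 ⟨i, hi⟩
    rw [Finset.card_erase_of_mem hi]
    omega
  obtain ⟨b, -, -, hbD⟩ := exists_partialD_eq_of_vanishing hy (j := j + 1)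
    (e := c - partialD y M n b₀)
    (fun S hS => by
      rcases eq_range_or_card_lt hS with rfl | h
      · rw [Pi.sub_apply, partialD_eq_of_subset b₀ (Finset.range_subset_range.2 hj) subset_rfl,
          hb₀, sub_self]
      · exact hD S h.ne)
    (fun S hS => hD S hS.ne')
    (fun S hS => by rw [map_sub, partialD_partialD, sub_zero, hc S hS]) n hj le_rfl
  refine ⟨b₀ + b, fun S hS => ?_⟩
  rw [map_add, Pi.add_apply, hbD S hS, Pi.sub_apply]
  abel

/-- The set [k] is the face of [k+1] lacking k. This is the one face not built into the module of
generalized fractions; the incoming differential supplies it. -/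
theorem locMap_mem_faceSum (k : ℕ) (b : LocAt y M (Finset.range k)) :
    locMap y M (Finset.range_subset_range.2 (Nat.le_succ k)) b ∈
      faceSum y M (Finset.range (k + 1)) (k + 1) := by
  have h : Finset.range k ⊆ (Finset.range (k + 1)).erase k := by
    rw [Finset.range_add_one, Finset.erase_insert (by simp)]
  refine Submodule.mem_iSup_of_mem k (Submodule.mem_iSup_of_mem (Finset.self_mem_range_succ k) ?_)
  exact ⟨locMap y M h b, locMap_locMap _ _ _⟩

theorem faceSum_mono (S : Finset ℕ) {q q' : ℕ} (h : q ≤ q') : faceSum y M S q ≤ faceSum y M S q' :=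
  biSup_mono fun _ hi => Finset.range_subset_range.2 h hi

theorem exists_fracPow_range_zero (z : LocAt y M (Finset.range 0)) : ∃ m, z = fracPow _ m 0 := by
  obtain ⟨m, α, rfl⟩ := exists_fracPow z
  exact ⟨m, fracPow_eq_iff.2 ⟨0, by rw [Finset.prod_range_zero, one_pow, one_pow]⟩⟩

end Cocycles

/-! ### Generalized fractions as quotients of localizations -/

section Comparison

open Matrix

variable {A : Type*} [CommRing A] {n : ℕ} [NeZero n] {M : Type*} [AddCommGroup M] [Module A M]
  (x : Fin n → A)

theorem lowIdeal_pow_seqTerm (k γ : ℕ) :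
    lowIdeal (fun r : Fin (k + 1) => seqTerm x r ^ γ) = powIdeal (seqTerm x) k γ := by
  refine congrArg Ideal.span (Set.ext fun a => ?_)
  constructor
  · rintro ⟨i, rfl⟩
    exact ⟨i, i.2, rfl⟩
  · rintro ⟨i, hi, rfl⟩
    exact ⟨⟨i, hi⟩, rfl⟩

/-- Multiplication by a diagonal matrix raises the exponents of `(x_1^γ, …, x_{k+1}^γ)`. -/
theorem diagonal_mulVec_pow (k : ℕ) (γ : Fin (k + 1) → ℕ) {δ : ℕ} (h : ∀ r, γ r ≤ δ) :
    diagonal (fun r : Fin (k + 1) => seqTerm x r ^ (δ - γ r)) *ᵥ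
      (fun r : Fin (k + 1) => seqTerm x r ^ γ r) = (powVec x k δ).1 := by
  ext r
  rw [mulVec_diagonal, ← pow_add, Nat.sub_add_cancel (h r)]
  rfl

theorem exists_mk_powVec (k : ℕ) (z : GenFrac (powSet x k) M) :
    ∃ m α, z = GenFrac.mk m (powVec x k α) := by
  induction z using GenFrac.ind with | h m u
  obtain ⟨_, γ, hγ, rfl⟩ := u
  exact ⟨_, Finset.univ.sup γ, GenFrac.mk_expand (w := powVec x k (Finset.univ.sup γ)) m
    (blockTriangular_diagonal _)
    (diagonal_mulVec_pow x k γ fun r => Finset.le_sup (Finset.mem_univ r))⟩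

/-- Vanishing is witnessed by an arbitrary lower triangular matrix; since determinants of matrices
with the same effect agree up to the allowed ambiguity, a diagonal one can replace it. The resulting
condition is precisely the one in `mem_faceSum_iff`. -/
theorem exists_pow_smul_mem_of_mk_eq_zero (k : ℕ) {m : M} {α : ℕ}
    (h : (GenFrac.mk m (powVec x k α) : GenFrac (powSet x k) M) = 0) :
    ∃ β, (∏ i ∈ Finset.range (k + 1), seqTerm x i) ^ β • m ∈
      powIdeal (seqTerm x) k (α + β) • (⊤ : Submodule A M) := by
  rw [← GenFrac.mk_zero (powVec x k α), GenFrac.mk_eq_mk_same, sub_zero] at h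
  obtain ⟨_, ⟨γ, _, rfl⟩, H, hH, e, hm⟩ := h
  set a := ∏ i ∈ Finset.range (k + 1), seqTerm x i with ha
  have ha' : a = ∏ r : Fin (k + 1), seqTerm x r := Finset.prod_range _
  -- Large enough for diagonal matrices to carry both the exponent α and all exponents γ to the
  -- common exponent δ.
  set δ := max α (Finset.univ.sup γ) with hδ
  have e₁ := diagonal_mulVec_pow x k γ (δ := δ)
    fun r => (Finset.le_sup (Finset.mem_univ r)).trans (le_max_right _ _)
  have e₂ := diagonal_mulVec_pow x k (fun _ => α) (δ := δ) fun _ => le_max_left _ _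
  set D₁ := diagonal (fun r : Fin (k + 1) => seqTerm x r ^ (δ - γ r))
  set D₂ := diagonal (fun r : Fin (k + 1) => seqTerm x r ^ (δ - α)) with hD₂
  set w := (powVec x k δ).1 with hw
  have h₁ : D₁.IsLowerTriangular := blockTriangular_diagonal _
  have h₂ : D₂.IsLowerTriangular := blockTriangular_diagonal _
  have m₁ := GenFrac.det_smul_mem h₁ e₁ hm
  have m₂ := GenFrac.det_smul_mem (blockTriangular_diagonal w) (GenFrac.diag_mulVec_self w) m₁
  -- Both D₁H and D₂ carry the vector of exponent α to w, so their determinants agree after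
  -- multiplication by the product of the entries of w, modulo the squares of those entries but the
  -- last. This squaring is why the final exponent is 2δ.
  have m₃ := GenFrac.det_smul_sub_mem (h₁.mul hH) h₂ (u := (powVec x k α).1) (w := w)
    (by rw [← mulVec_mulVec, e, e₁]) e₂ m
  have m₄ := Submodule.sub_mem _ m₂ m₃
  rw [smul_sub, det_mul, mul_smul, sub_sub_cancel] at m₄
  have hw₂ : (fun i => w i ^ 2) = fun r : Fin (k + 1) => seqTerm x r ^ (δ * 2) := by
    ext r
    rw [pow_mul]
    rfl
  have hdw : (diagonal w).det = a ^ δ := by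
    rw [det_diagonal, ha', ← Finset.prod_pow]
    rfl
  have hdD : D₂.det = a ^ (δ - α) := by rw [hD₂, det_diagonal, ha', ← Finset.prod_pow]
  rw [hw₂, lowIdeal_pow_seqTerm, hdw, hdD, smul_smul, ← pow_add] at m₄
  have hαδ : α ≤ δ := le_max_left _ _
  refine ⟨δ + (δ - α), ?_⟩
  rwa [show α + (δ + (δ - α)) = δ * 2 by omega]

variable (M) in
/-- The map `m / (x_1 ⋯ x_{k+1})^α ↦ m / (x_1^α, …, x_{k+1}^α)` on the localization at
`{0, …, k}`. -/
noncomputable def thetaAt (k : ℕ) :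
    LocAt (seqTerm x) M (Finset.range (k + 1)) →ₗ[A] GenFrac (powSet x k) M :=
  thetaTop M x k (Finset.prod_range _)

theorem thetaAt_fracPow (k : ℕ) (m : M) (α : ℕ) :
    thetaAt M x k (fracPow _ m α) = GenFrac.mk m (powVec x k α) :=
  thetaTop_fracPow x k _ m α

theorem thetaAt_surjective (k : ℕ) : Function.Surjective (thetaAt M x k) := by
  intro z
  obtain ⟨m, α, rfl⟩ := exists_mk_powVec x k z
  exact ⟨_, thetaAt_fracPow x k m α⟩

theorem mem_faceSum_of_thetaAt_eq_zero (k : ℕ) {z : LocAt (seqTerm x) M (Finset.range (k + 1))}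
    (h : thetaAt M x k z = 0) : z ∈ faceSum (seqTerm x) M (Finset.range (k + 1)) k := by
  obtain ⟨m, α, rfl⟩ := exists_fracPow z
  rw [thetaAt_fracPow] at h
  exact (mem_faceSum_iff (Finset.range_subset_range.2 (Nat.le_succ k))).2
    (exists_pow_smul_mem_of_mk_eq_zero x k h)

theorem thetaAt_locMap (k : ℕ) (z : LocAt (seqTerm x) M (Finset.range (k + 1))) :
    thetaAt M x (k + 1) (locMap _ M (Finset.range_subset_range.2 (Nat.le_succ (k + 1))) z) =
      GenFrac.appendOne _ _ (snoc_mem_powSet x k) (thetaAt M x k z) :=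
  thetaTop_awayMap_last x k _ _ _ z

theorem thetaAt_zero_locMap (m : M) :
    thetaAt M x 0 (locMap _ M (Finset.range_subset_range.2 (Nat.le_succ 0))
      (fracPow _ m 0)) = GenFrac.mkHom (powVec x 0 0) m := by
  refine (congrArg _ (awayMap_fracPow (c := ∏ i ∈ Finset.range 1, seqTerm x i) _
    (by rw [Finset.prod_range_zero, mul_one]) m 0)).trans ?_
  rw [pow_zero, one_smul]
  exact thetaAt_fracPow x 0 m 0

/-- With more than n entries the last two are both powers of x_n, so a suitable expansion of any
fraction has its numerator in the ideal of the preceding denominators. -/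
theorem genFrac_eq_zero {k : ℕ} (hk : n ≤ k) (z : GenFrac (powSet x k) M) : z = 0 := by
  obtain ⟨m, α, rfl⟩ := exists_mk_powVec x k z
  obtain ⟨k, rfl⟩ : ∃ k', k = k' + 1 := ⟨k - 1, by have := NeZero.pos n; omega⟩
  -- Expanding by the α-th power of the product contributes x_n^α twice, which is the last but one
  -- entry x_n^(2α) of the new denominator.
  rw [mk_powVec_eq x (k + 1) α α m]
  refine GenFrac.mk_eq_zero_of_mem (Submodule.smul_mem_smul ?_ trivial)
  have h : seqTerm x k ^ (α + α) ∈ lowIdeal (powVec x (k + 1) (α + α)).1 :=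
    GenFrac.mem_lowIdeal (powVec x (k + 1) (α + α)).1 (Fin.last k)
  refine Ideal.mem_of_dvd _ ?_ h
  rw [Fin.prod_univ_castSucc, Fin.prod_univ_castSucc, mul_assoc, mul_pow]
  refine Dvd.dvd.mul_left ?_ _
  simp only [Fin.val_castSucc, Fin.val_last]
  rw [seqTerm_of_ge x (r := k + 1) (s := k) (by omega) (by omega), mul_pow, pow_add]

/-- Each x_r lies in 𝔞, so x_r^N lies in the power 𝔞^N that carries m into the submodule. -/
theorem IsFilterRegular.isFilterSeq {x : Fin n → A} {𝔞 : Ideal A} (hx : IsFilterRegular 𝔞 M x) :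
    IsFilterSeq M (seqTerm x) n := by
  intro i hi r hr m hm
  have e : x '' {t | t < ⟨i, hi⟩} = seqTerm x '' Set.Iio i := by
    ext a
    constructor
    · rintro ⟨t, ht, rfl⟩
      exact ⟨t, ht, seqTerm_of_lt x t.2⟩
    · rintro ⟨t, ht, rfl⟩
      exact ⟨⟨t, lt_trans ht hi⟩, ht, (seqTerm_of_lt x (lt_trans ht hi)).symm⟩
  have h := hx.2 ⟨i, hi⟩
  rw [e] at h
  rw [seqTerm_of_lt x hi] at hm
  obtain ⟨N, -, hN⟩ := h hm
  refine ⟨N, hN _ (Ideal.pow_mem_pow ?_ N)⟩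
  rw [seqTerm_of_lt x hr]
  exact hx.1 _

end Comparison

/-! ### Passing between increasing sequences and finite sets of indices -/

section IndexSets

variable {A : Type*} [CommRing A] {n k : ℕ}

/-- The set of entries of a strictly increasing sequence. -/
def entries (T : Fin k ↪o Fin n) : Finset ℕ :=
  Finset.univ.map (T.toEmbedding.trans Fin.valEmbedding)

theorem mem_entries {T : Fin k ↪o Fin n} {i : ℕ} : i ∈ entries T ↔ ∃ r, (T r : ℕ) = i := by
  simp [entries]

theorem card_entries (T : Fin k ↪o Fin n) : (entries T).card = k := by
  rw [entries, Finset.card_map, Finset.card_univ, Fintype.card_fin]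

theorem entries_subset (T : Fin k ↪o Fin n) : entries T ⊆ Finset.range n := by
  intro i hi
  obtain ⟨r, rfl⟩ := mem_entries.1 hi
  exact Finset.mem_range.2 (T r).2

theorem entries_injective : Function.Injective (entries : (Fin k ↪o Fin n) → Finset ℕ) := by
  intro T T' h
  refine OrderEmbedding.range_inj.1 (Set.ext fun i => ?_)
  have h1 : (i : ℕ) ∈ entries T ↔ (i : ℕ) ∈ entries T' := by rw [h]
  simpa only [mem_entries, Fin.val_inj, Set.mem_range] using h1

theorem exists_entries_eq {S : Finset ℕ} (hS : S ⊆ Finset.range n) (hk : S.card = k) :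
    ∃ T : Fin k ↪o Fin n, entries T = S := by
  have h : ∀ i ∈ S, i < n := fun i hi => Finset.mem_range.1 (hS hi)
  have hc : (S.attachFin h).card = k := by rw [Finset.card_attachFin, hk]
  refine ⟨(S.attachFin h).orderEmbOfFin hc, ?_⟩
  ext i
  rw [mem_entries]
  constructor
  · rintro ⟨r, rfl⟩
    exact Finset.mem_attachFin h |>.1 (Finset.orderEmbOfFin_mem _ hc r)
  · intro hi
    have h1 : (⟨i, h i hi⟩ : Fin n) ∈ Set.range ((S.attachFin h).orderEmbOfFin hc) := by
      rw [Finset.range_orderEmbOfFin]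
      exact Finset.mem_coe.2 ((Finset.mem_attachFin h).2 hi)
    obtain ⟨r, hr⟩ := h1
    exact ⟨r, by rw [hr]⟩

theorem entries_castLE (h : k ≤ n) : entries (Fin.castLEOrderEmb h) = Finset.range k := by
  ext i
  rw [mem_entries, Finset.mem_range]
  constructor
  · rintro ⟨r, rfl⟩
    exact r.2
  · intro hi
    exact ⟨⟨i, hi⟩, rfl⟩

theorem entries_delEntry (T : Fin (k + 1) ↪o Fin n) (p : Fin (k + 1)) :
    entries (delEntry T p) = (entries T).erase (T p) := by
  ext i
  rw [mem_entries, Finset.mem_erase, mem_entries]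
  constructor
  · rintro ⟨r, rfl⟩
    exact ⟨fun h => Fin.succAbove_ne p r (T.injective (Fin.ext h)), _, rfl⟩
  · rintro ⟨h, r, rfl⟩
    obtain ⟨s, hs⟩ := Fin.exists_succAbove_eq (x := r) (y := p) (fun e => h (by rw [e]))
    exact ⟨s, by rw [← hs]; rfl⟩

/-- The entries of T below T p are exactly the p entries that precede it, so the two sign
conventions agree. -/
theorem faceSign_entries (T : Fin (k + 1) ↪o Fin n) (p : Fin (k + 1)) :
    faceSign A (entries T) (T p) = (-1) ^ (p : ℕ) := by
  have h : (entries T).filter (· < (T p : ℕ)) =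
      (Finset.Iio p).map (T.toEmbedding.trans Fin.valEmbedding) := by
    ext i
    simp only [Finset.mem_filter, mem_entries, Finset.mem_map, Finset.mem_Iio]
    constructor
    · rintro ⟨⟨r, rfl⟩, hr⟩
      exact ⟨r, T.lt_iff_lt.1 hr, rfl⟩
    · rintro ⟨r, hr, rfl⟩
      exact ⟨⟨r, rfl⟩, T.lt_iff_lt.2 hr⟩
  rw [faceSign, h, Finset.card_map, Fin.card_Iio]

variable {M : Type*} [AddCommGroup M] [Module A M] {x : Fin n → A}

theorem cechTerm_eq (hk : n < k) (c c' : CechTerm M x k) : c = c' := by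
  ext T
  have := Fintype.card_le_of_injective T T.injective
  simp only [Fintype.card_fin] at this
  omega

variable [NeZero n]

variable (x) in
theorem prod_entries (T : Fin k ↪o Fin n) : ∏ i ∈ entries T, seqTerm x i = cechProd x T := by
  rw [entries, Finset.prod_map]
  exact Finset.prod_congr rfl fun r _ => seqTerm_of_lt x (T r).2

/-- The components of a family of elements of the localizations that occur in the Čech complex. -/
noncomputable def toCech (M : Type*) [AddCommGroup M] [Module A M] (x : Fin n → A) (k : ℕ) :
    Cochain (seqTerm x) M →ₗ[A] CechTerm M x k :=
  LinearMap.pi fun T => awayMap M (prod_entries x T).dvd ∘ₗ LinearMap.proj (entries T)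

theorem toCech_apply (c : Cochain (seqTerm x) M) (T : Fin k ↪o Fin n) :
    toCech M x k c T = awayMap M (prod_entries x T).dvd (c (entries T)) := rfl

theorem awayMap_congr_finset {y : ℕ → A} (c : Cochain y M) {S S' : Finset ℕ} (e : S = S') {b : A}
    (h : ∏ i ∈ S, y i ∣ b) (h' : ∏ i ∈ S', y i ∣ b) :
    awayMap M h (c S) = awayMap M h' (c S') := by subst e; rfl

theorem toCech_partialD_apply (c : Cochain (seqTerm x) M) (T : Fin (k + 1) ↪o Fin n) :
    toCech M x (k + 1) (partialD _ M n c) T = ∑ p : Fin (k + 1),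
      (-1 : A) ^ (p : ℕ) • awayMap M (cechProd_dvd x T p) (toCech M x k c (delEntry T p)) := by
  rw [toCech_apply, partialD_apply, Finset.filter_true_of_mem
    fun i hi => Finset.mem_range.1 (entries_subset T hi), map_sum]
  refine (Finset.sum_map _ (T.toEmbedding.trans Fin.valEmbedding) _).trans ?_
  refine Finset.sum_congr rfl fun p _ => ?_
  rw [map_smul, toCech_apply, awayMap_awayMap]
  refine congrArg₂ _ (faceSign_entries T p) ((awayMap_awayMap _ _ _).trans ?_)
  exact awayMap_congr_finset c (entries_delEntry T p).symm _ _

theorem toCech_partialD (c : Cochain (seqTerm x) M) :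
    toCech M x (k + 2) (partialD _ M n c) = cechD M x k (toCech M x (k + 1) c) := by
  ext T
  rw [toCech_partialD_apply, cechD_apply]

/-- The degree zero term of the Čech complex is M itself, not the localization at the empty product,
so the first differential needs its own comparison. -/
theorem toCech_partialD_one {c : Cochain (seqTerm x) M} {m : M} (h : c (Finset.range 0) = fracPow _ m 0) :
    toCech M x 1 (partialD _ M n c) = cechD₀ M x m := by
  ext T
  rw [toCech_partialD_apply, Fin.sum_univ_one, toCech_apply, awayMap_awayMap,
    awayMap_congr_finset c (S' := Finset.range 0) (by ext; simp [mem_entries])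
      _ (by rw [Finset.prod_range_zero]; exact one_dvd _), h,
    awayMap_fracPow (c := cechProd x T) _ (by rw [Finset.prod_range_zero, mul_one]), pow_zero, one_smul,
    Fin.val_zero, pow_zero, one_smul]
  change LocalizedModule.mk m _ = LocalizedModule.mk m 1
  congr 1
  exact Subtype.ext (pow_zero _)

theorem awayMap_injective_of_eq {a b : A} (e : a = b) (h : a ∣ b) :
    Function.Injective (awayMap M h) := by
  subst e
  intro z z' hz
  rwa [awayMap_self, awayMap_self] at hz

theorem eq_zero_of_toCech_eq_zero {c : Cochain (seqTerm x) M} (h : toCech M x k c = 0)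
    {S : Finset ℕ} (hS : S ⊆ Finset.range n) (hk : S.card = k) : c S = 0 := by
  obtain ⟨T, rfl⟩ := exists_entries_eq hS hk
  refine awayMap_injective_of_eq (prod_entries x T) (prod_entries x T).dvd ?_
  rw [map_zero]
  exact congrFun h T

theorem toCech_eq_of_forall {c c' : Cochain (seqTerm x) M}
    (h : ∀ S ⊆ Finset.range n, c S = c' S) : toCech M x k c = toCech M x k c' := by
  ext T
  rw [toCech_apply, toCech_apply, h _ (entries_subset T)]

/-- An increasing sequence is determined by its set of entries, so prescribing components on those
sets is consistent; all other components may be zero. -/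
theorem exists_toCech_eq (c : CechTerm M x k) :
    ∃ C : Cochain (seqTerm x) M, toCech M x k C = c ∧ ∀ S, S.card ≠ k → C S = 0 := by
  classical
  have key : ∀ S : Finset ℕ, ∃ z : LocAt (seqTerm x) M S, ∀ T : Fin k ↪o Fin n,
      (e : entries T = S) → awayMap M (by rw [← e, prod_entries]) z = c T := by
    intro S
    by_cases h : ∃ T : Fin k ↪o Fin n, entries T = S
    · obtain ⟨T, rfl⟩ := h
      refine ⟨awayMap M (prod_entries x T).symm.dvd (c T), fun T' e => ?_⟩
      obtain rfl := entries_injective e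
      rw [awayMap_awayMap, awayMap_self]
    · exact ⟨0, fun T e => absurd ⟨T, e⟩ h⟩
  choose C hC using key
  refine ⟨Cochain.restrict (fun S => S.card = k) C, ?_, fun S hS => Cochain.restrict_of_neg _ hS⟩
  ext T
  rw [toCech_apply, Cochain.restrict_of_pos _ (card_entries T)]
  exact hC _ T rfl

theorem theta_toCech (hk : k + 1 ≤ n) (c : Cochain (seqTerm x) M) :
    theta M x k (toCech M x (k + 1) c) = thetaAt M x k (c (Finset.range (k + 1))) := by
  have key : ∀ {a b : A} (ha : a = ∏ r : Fin (k + 1), seqTerm x r)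
      (hb : b = ∏ r : Fin (k + 1), seqTerm x r) (h : a ∣ b)
      (z : LocalizedModule (Submonoid.powers a) M),
      thetaTop M x k hb (awayMap M h z) = thetaTop M x k ha z := by
    intro a b ha hb h z
    obtain rfl : a = b := ha.trans hb.symm
    rw [awayMap_self]
  rw [theta_of_le x hk, toCech_apply, awayMap_congr_finset c (entries_castLE hk) _
    (by rw [← entries_castLE hk, prod_entries]), key (Finset.prod_range _)]
  rfl

end IndexSets

/-! ### Injectivity and surjectivity on cohomology -/

section Cohomology

variable {A : Type*} [CommRing A] {n : ℕ} [NeZero n] {M : Type*} [AddCommGroup M] [Module A M]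
  {x : Fin n → A} {k : ℕ}

theorem exists_cocycle_of_appendOne_eq_zero (hx : IsFilterSeq M (seqTerm x) n)
    (z : GenFrac (powSet x k) M) (hz : GenFrac.appendOne _ _ (snoc_mem_powSet x k) z = 0) :
    ∃ c : CechTerm M x (k + 1), cechD M x k c = 0 ∧ theta M x k c = z := by
  obtain ⟨z, rfl⟩ := thetaAt_surjective x k z
  rcases lt_trichotomy n (k + 1) with h | h | h
  · exact ⟨0, map_zero _, (genFrac_eq_zero x (by omega) _).trans
      (genFrac_eq_zero x (by omega) _).symm⟩
  -- In degree n there is no Čech term above, so any cochain with component z at [n] is a cocycle.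
  · refine ⟨toCech M x (k + 1) (Pi.single _ z), cechTerm_eq (by omega) _ _, ?_⟩
    rw [theta_toCech h.ge, Pi.single_eq_same]
  · rw [← thetaAt_locMap] at hz
    obtain ⟨c, hc, rfl⟩ := exists_cocycle hx h (mem_faceSum_of_thetaAt_eq_zero x _ hz)
    refine ⟨toCech M x (k + 1) c, ?_, theta_toCech h.le c⟩
    rw [← toCech_partialD, toCech_eq_of_forall (c' := 0) hc, map_zero]

theorem cechD₀_eq_zero (hx : IsFilterSeq M (seqTerm x) n) {m : M}
    (hm : GenFrac.mkHom (powVec x 0 0) m = 0) : cechD₀ M x m = 0 := by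
  rw [← thetaAt_zero_locMap] at hm
  obtain ⟨c, hc, h⟩ := exists_cocycle hx (NeZero.pos n) (mem_faceSum_of_thetaAt_eq_zero x _ hm)
  rw [← toCech_partialD_one h, toCech_eq_of_forall (c' := 0) hc, map_zero]

/-- The component of c at [k+1] is the image of b plus an element killed by `thetaAt`. The former
comes from the face lacking k, the latter from the faces lacking some i < k, so all of it comes from
faces and `exists_coboundary` applies. Taking b in the localization at [k] treats degree one and the
higher degrees together. -/
theorem exists_toCech_partialD_eq (hx : IsFilterSeq M (seqTerm x) n) {c : CechTerm M x (k + 1)}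
    (hc : cechD M x k c = 0) (b : LocAt (seqTerm x) M (Finset.range k))
    (h : theta M x k c = thetaAt M x k
      (locMap _ M (Finset.range_subset_range.2 (Nat.le_succ k)) b)) :
    ∃ B : Cochain (seqTerm x) M, toCech M x (k + 1) (partialD _ M n B) = c := by
  rcases lt_or_ge n (k + 1) with hk | hk
  · exact ⟨0, cechTerm_eq hk _ _⟩
  obtain ⟨C, rfl, hC⟩ := exists_toCech_eq c
  rw [theta_toCech hk, ← sub_eq_zero, ← map_sub] at h
  have h1 := Submodule.add_mem _
    (faceSum_mono _ (Nat.le_succ k) (mem_faceSum_of_thetaAt_eq_zero x _ h)) (locMap_mem_faceSum k b)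
  rw [sub_add_cancel] at h1
  rw [← toCech_partialD] at hc
  obtain ⟨B, hB⟩ := exists_coboundary hx hk (fun S hS => by
    by_cases hcard : S.card = k + 2
    · exact eq_zero_of_toCech_eq_zero hc hS hcard
    · refine partialD_eq_zero fun i hi _ => hC _ ?_
      have := Finset.card_pos.2 ⟨i, hi⟩
      rw [Finset.card_erase_of_mem hi]
      omega) hC h1
  exact ⟨B, toCech_eq_of_forall hB⟩

theorem exists_cechD₀_eq (hx : IsFilterSeq M (seqTerm x) n) {c : CechTerm M x 1}
    (hc : cechD M x 0 c = 0) (m : M) (h : theta M x 0 c = GenFrac.mkHom (powVec x 0 0) m) :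
    ∃ m', cechD₀ M x m' = c := by
  rw [← thetaAt_zero_locMap] at h
  obtain ⟨B, rfl⟩ := exists_toCech_partialD_eq hx hc _ h
  obtain ⟨m', hm'⟩ := exists_fracPow_range_zero (B (Finset.range 0))
  exact ⟨m', (toCech_partialD_one hm').symm⟩

theorem exists_cechD_eq (hx : IsFilterSeq M (seqTerm x) n) {c : CechTerm M x (k + 2)}
    (hc : cechD M x (k + 1) c = 0) (z : GenFrac (powSet x k) M)
    (h : theta M x (k + 1) c = GenFrac.appendOne _ _ (snoc_mem_powSet x k) z) :
    ∃ b, cechD M x k b = c := by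
  obtain ⟨z, rfl⟩ := thetaAt_surjective x k z
  rw [← thetaAt_locMap] at h
  obtain ⟨B, rfl⟩ := exists_toCech_partialD_eq hx hc _ h
  exact ⟨_, (toCech_partialD B).symm⟩

end Cohomology

/-! ### The differentials and the conclusion degree by degree -/

section Differentials

open CategoryTheory

variable {A : Type u} [CommRing A] {n : ℕ} (x : Fin n → A)
  (M : Type u) [AddCommGroup M] [Module A M]

theorem cechComplex_d (i : ℕ) : (cechComplex x M).d i (i + 1) = cechXD x M i :=
  CochainComplex.of_d _ _ _

theorem genFracComplex_d [NeZero n] (i : ℕ) : (genFracComplex x M).d i (i + 1) = genFracD x M i :=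
  CochainComplex.of_d _ _ _

end Differentials

/-- If `x_1, …, x_n` is an `𝔞`-filter regular sequence on the finitely generated `A`-module `M`,
where `𝔞 = (x_1, …, x_n)`, then `Θ_x` is a quasi-isomorphism. -/
theorem theorem1p5 {A : Type u} [CommRing A] [IsNoetherianRing A]
    {M : Type u} [AddCommGroup M] [Module A M] [Module.Finite A M]
    {n : ℕ} [NeZero n] (x : Fin n → A)
    (hx : IsFilterRegular (Ideal.span (Set.range x)) M x) :
    QuasiIso (Theta x M) := by
  have hy := hx.isFilterSeq
  refine ⟨fun i => ?_⟩
  rcases i with _ | i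
  · rw [quasiIsoAt_iff' _ 0 0 1 CochainComplex.prev_nat_zero (CochainComplex.next ℕ 0)]
    refine shortComplex_quasiIso_of_forall _ ?_ ?_
    · intro m hm w hw
      refine ⟨0, ?_⟩
      -- The index preceding 0 is by convention 0 itself, with zero differential, and the component
      -- in degree 0 is the identity; injectivity is immediate.
      have h : (genFracComplex x M).d 0 0 = 0 := (genFracComplex x M).shape 0 0 (by simp)
      change _ = ((genFracComplex x M).d 0 0).hom w at hw
      rw [h] at hw
      rw [map_zero]
      exact hw.symm
    · intro m hm
      change ((genFracComplex x M).d 0 1).hom m = 0 at hm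
      rw [genFracComplex_d x M 0] at hm
      refine ⟨m, ?_, 0, ?_⟩
      · change ((cechComplex x M).d 0 1).hom m = 0
        rw [cechComplex_d x M 0]
        exact cechD₀_eq_zero hy hm
      · rw [map_zero, add_zero]
        rfl
  · rw [quasiIsoAt_iff' _ i (i + 1) (i + 2) (CochainComplex.prev_nat_succ i)
      (CochainComplex.next ℕ (i + 1))]
    refine shortComplex_quasiIso_of_forall _ ?_ ?_
    · intro c hc z hz
      change ((cechComplex x M).d (i + 1) (i + 1 + 1)).hom c = 0 at hc
      change theta M x i c = ((genFracComplex x M).d i (i + 1)).hom z at hz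
      change ∃ b, ((cechComplex x M).d i (i + 1)).hom b = c
      rw [cechComplex_d] at hc ⊢
      rw [genFracComplex_d] at hz
      rcases i with _ | k
      · exact exists_cechD₀_eq hy hc z hz
      -- The sign of the differential is absorbed into the preimage z.
      · refine exists_cechD_eq hy hc ((-1 : A) ^ (k + 1) • (z : GenFrac (powSet x k) M)) ?_
        exact hz.trans (map_smul (GenFrac.appendOne (M := M) _ _ (snoc_mem_powSet x k)) _ _).symm
    · intro z hz
      change ((genFracComplex x M).d (i + 1) (i + 1 + 1)).hom z = 0 at hz
      rw [genFracComplex_d] at hz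
      have hz' : GenFrac.appendOne _ _ (snoc_mem_powSet x i) (z : GenFrac (powSet x i) M) = 0 := by
        have h := congrArg (fun w => (-1 : A) ^ (i + 1) • w)
          (show (-1 : A) ^ (i + 1) • GenFrac.appendOne _ _ (snoc_mem_powSet x i)
            (z : GenFrac (powSet x i) M) = 0 from hz)
        simpa only [smul_smul, ← mul_pow, neg_mul_neg, one_mul, one_pow, one_smul, smul_zero] using h
      obtain ⟨c, hc, hcz⟩ := exists_cocycle_of_appendOne_eq_zero hy _ hz'
      -- Cocycles lift exactly, so no coboundary correction is needed.
      refine ⟨c, ?_, 0, ?_⟩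
      · change ((cechComplex x M).d (i + 1) (i + 1 + 1)).hom c = 0
        rw [cechComplex_d]
        exact hc
      · rw [map_zero, add_zero]
        exact hcz
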